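/- Write $\mathbb N=\{1,2,\dots\}$ and $\mathbb N_0=\mathbb N\cup\{0\}$. Let $s$ be the Fréchet space of all $\xi\in\mathbb C^{\mathbb N}$ with $|\xi|_q:=\big(\sum_{j}|\xi_j|^2j^{2q}\big)^{1/2}<\infty$ for all $q\in\mathbb N_0$, with the topology given by the norms $|\cdot|_q$, and let $s'$ be the space of all $\eta\in\mathbb C^{\mathbb N}$ with $|\eta|'_q:=\big(\sum_j|\eta_j|^2j^{-2q}\big)^{1/2}<\infty$ for some $q\in\mathbb N_0$, with the locally convex inductive limit topology given by the norms $|\cdot|'_q$. Put $\langle\eta,\xi\rangle:=\sum_j\eta_j\overline{\xi_j}$. Let $\mathcal L(s',s)$ be the space of continuous linear operators from $s'$ to $s$ with the topology of uniform convergence on bounded subsets of $s'$; via $s\hookrightarrow\ell_2\hookrightarrow s'$ it embeds into $\mathcal L(\ell_2)$ and carries the product and the involution (hermitian adjoint) of $\mathcal L(\ell_2)$. For an infinite-dimensional closed commutative ${}^*$-subalgebra $E$ of $\mathcal L(s',s)$, an enumeration $(P_k)_{k\in\mathbb N}$, without repetition, of all nonzero minimal projections (self-adjoint idempotents) of $E$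 is called a canonical basis of $E$. For a matrix $A=(a_{k,q})_{k\in\mathbb N,q\in\mathbb N_0}$ with entries $\ge 1$ and non-decreasing in $q$, let $\lambda^\infty(A)$ be the algebra of all $\xi\in\mathbb C^{\mathbb N}$ with $\sup_k|\xi_k|a_{k,q}<\infty$ for all $q$, with the topology given by these seminorms and with coordinatewise multiplication and conjugation; $e_k$ denotes its $k$-th unit vector. An isomorphism of Fréchet ${}^*$-algebras is a ${}^*$-algebra isomorphism that is a homeomorphism. A sequence $(P_k)$ in $E$ is a Schauder basis of $E$ if each $x\in E$ has a unique convergent expansion $x=\sum_kc_kP_k$ with $c_k\in\mathbb C$. (1) For every infinite-dimensional closed commutative ${}^*$-subalgebra $E$ of $\mathcal L(s',s)$ there are a sequence $(f_j)_{j\in\mathbb N}\subset s$, orthonormal in $\ell_2$, and a family $(\mathcal N_k)_{k\in\mathbb N}$ of finite nonempty pairwise disjoint subsets of $\mathbb N$ such that $\big(\sum_{j\in\mathcal N_k}\langle\cdot,f_j\rangle f_j\big)_{k\in\mathbb N}$ is a canonical basis of $E$, is a Schauder basis of $E$, and $$E\cong\lambda^\infty\Big(\max_{j\in\mathcal N_k}|f_j|_q\Big)$$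 as Fréchet ${}^*$-algebras, by an isomorphism with $\sum_{j\in\mathcal N_k}\langle\cdot,f_j\rangle f_j\mapsto e_k$ for all $k\in\mathbb N$. (2) In fact, if $E$ is an infinite-dimensional closed commutative ${}^*$-subalgebra of $\mathcal L(s',s)$, $(f_j)_{j\in\mathbb N}\subset s$ is any orthonormal sequence and $(\mathcal N_k)_{k\in\mathbb N}$ is any family of finite nonempty pairwise disjoint subsets of $\mathbb N$ such that $\big(\sum_{j\in\mathcal N_k}\langle\cdot,f_j\rangle f_j\big)_{k}$ is a canonical basis of $E$, then it is a Schauder basis of $E$ and $E\cong\lambda^\infty(\max_{j\in\mathcal N_k}|f_j|_q)$ as Fréchet ${}^*$-algebras by an isomorphism with $\sum_{j\in\mathcal N_k}\langle\cdot,f_j\rangle f_j\mapsto e_k$ for all $k$. (3) Conversely, if $(f_j)_{j\in\mathbb N}\subset s$ is an orthonormal sequence and $(\mathcal N_k)_{k\in\mathbb N}$ is a family of finite nonempty pairwise disjoint subsets of $\mathbb N$, then there is an infinite-dimensional closed commutative ${}^*$-subalgebra $E$ of $\mathcal L(s',s)$ for which $\big(\sum_{j\in\mathcal N_k}\langle\cdot,f_j\rangle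 f_j\big)_k$ is a canonical basis and a Schauder basis, and $\lambda^\infty(\max_{j\in\mathcal N_k}|f_j|_q)$ is isomorphic to $E$ as a Fréchet ${}^*$-algebra by an isomorphism with $e_k\mapsto\sum_{j\in\mathcal N_k}\langle\cdot,f_j\rangle f_j$ for all $k$. -/

import Mathlib

open scoped ComplexConjugate

noncomputable section

namespace SmoothOperators

/-! ### Weighted `ℓ²` norms

Sequences are indexed by `ℕ = {0, 1, 2, …}`; the entry with index `j` here is the entry with
index `j + 1` in the convention `ℕ = {1, 2, …}`, so the weight `j ^ t` becomes `(j + 1) ^ t`. -/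

/-- The weighted `ℓ²` sum of `ξ` with exponent `t` is finite. -/
def SqSummable (t : ℤ) (ξ : ℕ → ℂ) : Prop :=
  Summable fun j : ℕ => ‖ξ j‖ ^ 2 * ((j : ℝ) + 1) ^ (2 * t)

/-- The weighted `ℓ²` norm with exponent `t`. -/
def wNorm (t : ℤ) (ξ : ℕ → ℂ) : ℝ :=
  √(∑' j : ℕ, ‖ξ j‖ ^ 2 * ((j : ℝ) + 1) ^ (2 * t))

/-- The Hilbert space of square summable sequences. -/
abbrev L2 : Type := lp (fun _ : ℕ => ℂ) 2

/-- Multiplication of a sequence by the weight. -/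
def weighted (t : ℤ) (ξ : ℕ → ℂ) : ℕ → ℂ := fun j => ((((j : ℝ) + 1) ^ t : ℝ) : ℂ) * ξ j

theorem norm_weighted_sq (t : ℤ) (ξ : ℕ → ℂ) (j : ℕ) :
    ‖weighted t ξ j‖ ^ 2 = ‖ξ j‖ ^ 2 * ((j : ℝ) + 1) ^ (2 * t) := by
  have h : (0 : ℝ) < (j : ℝ) + 1 := by positivity
  have h2 : ((j : ℝ) + 1) ^ (2 * t) = (((j : ℝ) + 1) ^ t) ^ 2 := by
    rw [mul_comm, zpow_mul]; norm_cast
  rw [weighted, norm_mul, Complex.norm_real, Real.norm_of_nonneg (by positivity), mul_pow, h2,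
    mul_comm]

theorem sqSummable_iff (t : ℤ) (ξ : ℕ → ℂ) : SqSummable t ξ ↔ Memℓp (weighted t ξ) 2 := by
  rw [memℓp_gen_iff (by norm_num), SqSummable]
  refine summable_congr fun j => ?_
  rw [← norm_weighted_sq]
  norm_num

/-- The weighted sequence as an element of `ℓ²`. -/
def weightedL2 (t : ℤ) (ξ : ℕ → ℂ) (h : SqSummable t ξ) : L2 :=
  ⟨weighted t ξ, (sqSummable_iff t ξ).1 h⟩

theorem wNorm_eq_norm (t : ℤ) (ξ : ℕ → ℂ) (h : SqSummable t ξ) :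
    wNorm t ξ = ‖weightedL2 t ξ h‖ := by
  rw [lp.norm_eq_tsum_rpow (by norm_num), wNorm, Real.sqrt_eq_rpow]
  have h2 : (2 : ENNReal).toReal = 2 := by norm_num
  rw [h2]
  congr 1
  refine tsum_congr fun j => ?_
  rw [← norm_weighted_sq, ← Real.rpow_natCast]
  rfl

theorem wNorm_nonneg (t : ℤ) (ξ : ℕ → ℂ) : 0 ≤ wNorm t ξ := Real.sqrt_nonneg _

theorem SqSummable.zero (t : ℤ) : SqSummable t 0 := by
  simp [SqSummable, summable_zero]

theorem weighted_add (t : ℤ) (ξ η : ℕ → ℂ) :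
    weighted t (ξ + η) = weighted t ξ + weighted t η := by
  funext j; simp [weighted, mul_add]

theorem weighted_smul (t : ℤ) (c : ℂ) (ξ : ℕ → ℂ) : weighted t (c • ξ) = c • weighted t ξ := by
  funext j; simp only [weighted, Pi.smul_apply, smul_eq_mul]; ring

theorem SqSummable.add {t : ℤ} {ξ η : ℕ → ℂ} (h : SqSummable t ξ) (h' : SqSummable t η) :
    SqSummable t (ξ + η) := by
  rw [sqSummable_iff] at *
  rw [weighted_add]
  exact h.add h'

theorem SqSummable.smul {t : ℤ} {ξ : ℕ → ℂ} (c : ℂ) (h : SqSummable t ξ) :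
    SqSummable t (c • ξ) := by
  rw [sqSummable_iff] at *
  rw [weighted_smul]
  exact h.const_smul c

theorem wNorm_add_le {t : ℤ} {ξ η : ℕ → ℂ} (h : SqSummable t ξ) (h' : SqSummable t η) :
    wNorm t (ξ + η) ≤ wNorm t ξ + wNorm t η := by
  rw [wNorm_eq_norm t _ (h.add h'), wNorm_eq_norm t _ h, wNorm_eq_norm t _ h']
  have : weightedL2 t (ξ + η) (h.add h') = weightedL2 t ξ h + weightedL2 t η h' :=
    Subtype.ext (weighted_add t ξ η)
  rw [this]
  exact norm_add_le _ _

theorem wNorm_smul (t : ℤ) (c : ℂ) (ξ : ℕ → ℂ) : wNorm t (c • ξ) = ‖c‖ * wNorm t ξ := by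
  have : ∀ j : ℕ, ‖(c • ξ) j‖ ^ 2 * ((j : ℝ) + 1) ^ (2 * t)
      = ‖c‖ ^ 2 * (‖ξ j‖ ^ 2 * ((j : ℝ) + 1) ^ (2 * t)) := fun j => by
    simp only [Pi.smul_apply, smul_eq_mul, norm_mul]; ring
  rw [wNorm, tsum_congr this, tsum_mul_left, Real.sqrt_mul (by positivity),
    Real.sqrt_sq (norm_nonneg c), wNorm]

theorem weight_mono {t u : ℤ} (htu : t ≤ u) (j : ℕ) :
    ((j : ℝ) + 1) ^ (2 * t) ≤ ((j : ℝ) + 1) ^ (2 * u) :=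
  zpow_le_zpow_right₀ (by simp) (by omega)

theorem SqSummable.mono {t u : ℤ} (htu : t ≤ u) {ξ : ℕ → ℂ} (h : SqSummable u ξ) :
    SqSummable t ξ :=
  Summable.of_nonneg_of_le (fun j => by positivity)
    (fun j => mul_le_mul_of_nonneg_left (weight_mono htu j) (by positivity)) h

theorem wNorm_mono {t u : ℤ} (htu : t ≤ u) {ξ : ℕ → ℂ} (h : SqSummable u ξ) :
    wNorm t ξ ≤ wNorm u ξ :=
  Real.sqrt_le_sqrt (Summable.tsum_le_tsum
    (fun j => mul_le_mul_of_nonneg_left (weight_mono htu j) (by positivity)) (h.mono htu) h)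

/-! ### The pairing `⟨η, ξ⟩ = ∑ η_j conj(ξ_j)` -/

/-- The pairing `∑ η_j conj(ξ_j)`. -/
def pairing (η ξ : ℕ → ℂ) : ℂ := ∑' j : ℕ, η j * conj (ξ j)

theorem pairing_term {t : ℤ} (η ξ : ℕ → ℂ) (j : ℕ) :
    inner ℂ (weighted t ξ j) (weighted (-t) η j) = η j * conj (ξ j) := by
  have h : ((((j : ℝ) + 1) ^ t : ℝ) : ℂ) ≠ 0 := by
    have : (0 : ℝ) < ((j : ℝ) + 1) ^ t := by positivity
    exact_mod_cast this.ne'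
  simp only [weighted, RCLike.inner_apply, map_mul, Complex.conj_ofReal, zpow_neg,
    Complex.ofReal_inv]
  field_simp

theorem summable_pairing {t : ℤ} {η ξ : ℕ → ℂ} (hη : SqSummable (-t) η) (hξ : SqSummable t ξ) :
    Summable fun j : ℕ => η j * conj (ξ j) := by
  have := lp.summable_inner (𝕜 := ℂ) (weightedL2 t ξ hξ) (weightedL2 (-t) η hη)
  exact this.congr fun j => (pairing_term η ξ j)

theorem norm_pairing_le {t : ℤ} {η ξ : ℕ → ℂ} (hη : SqSummable (-t) η) (hξ : SqSummable t ξ) :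
    ‖pairing η ξ‖ ≤ wNorm (-t) η * wNorm t ξ := by
  have h : pairing η ξ = inner ℂ (weightedL2 t ξ hξ) (weightedL2 (-t) η hη) := by
    rw [lp.inner_eq_tsum]
    exact tsum_congr fun j => (pairing_term η ξ j).symm
  rw [h, wNorm_eq_norm _ _ hη, wNorm_eq_norm _ _ hξ, mul_comm]
  exact norm_inner_le_norm _ _

/-! ### The space `s` of rapidly decreasing sequences -/

/-- The rapidly decreasing sequences, as a linear subspace of `ℂ^ℕ`. -/
def rapidSubmodule : Submodule ℂ (ℕ → ℂ) where
  carrier := {ξ | ∀ q : ℕ, SqSummable q ξ}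
  zero_mem' := fun q => SqSummable.zero q
  add_mem' := fun h h' q => (h q).add (h' q)
  smul_mem' := fun c _ h q => (h q).smul c

/-- The space `s`. It is a type of its own because its topology is not the topology of
coordinatewise convergence. -/
def SSpace : Type := rapidSubmodule

instance : AddCommGroup SSpace := inferInstanceAs (AddCommGroup rapidSubmodule)
instance : Module ℂ SSpace := inferInstanceAs (Module ℂ rapidSubmodule)
instance : CoeFun SSpace (fun _ => ℕ → ℂ) := ⟨fun ξ => ξ.1⟩

/-- The norm `|ξ|_q = (∑ |ξ_j|² j^{2q})^{1/2}` on `s`. -/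
def sNorm : SeminormFamily ℂ SSpace ℕ := fun q =>
  Seminorm.of (fun ξ => wNorm q ξ) (fun ξ η => wNorm_add_le (ξ.2 q) (η.2 q))
    (fun c ξ => wNorm_smul q c ξ)

instance : TopologicalSpace SSpace := sNorm.moduleFilterBasis.topology

theorem withSeminorms_sNorm : WithSeminorms sNorm := ⟨rfl⟩

instance : IsTopologicalAddGroup SSpace := withSeminorms_sNorm.topologicalAddGroup
instance : ContinuousSMul ℂ SSpace := withSeminorms_sNorm.continuousSMul

/-! ### The space `s'` of slowly increasing sequences -/

/-- The slowly increasing sequences, as a linear subspace of `ℂ^ℕ`. -/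
def slowSubmodule : Submodule ℂ (ℕ → ℂ) where
  carrier := {η | ∃ q : ℕ, SqSummable (-q) η}
  zero_mem' := ⟨0, SqSummable.zero _⟩
  add_mem' := by
    rintro η θ ⟨q, h⟩ ⟨r, h'⟩
    exact ⟨max q r, (h.mono (by push_cast; omega)).add (h'.mono (by push_cast; omega))⟩
  smul_mem' := fun c _ ⟨q, h⟩ => ⟨q, h.smul c⟩

/-- The space `s'`. -/
def SDual : Type := slowSubmodule

instance : AddCommGroup SDual := inferInstanceAs (AddCommGroup slowSubmodule)
instance : Module ℂ SDual := inferInstanceAs (Module ℂ slowSubmodule)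
instance : CoeFun SDual (fun _ => ℕ → ℂ) := ⟨fun ξ => ξ.1⟩

/-- The seminorms on `s'` whose restriction to each step
`{η | |η|'_q < ∞}` is continuous with respect to the norm `|·|'_q` of the step. -/
def StepContinuousSeminorm : Type :=
  {p : Seminorm ℂ SDual //
    ∀ q : ℕ, ∃ C : ℝ, ∀ η : SDual, SqSummable (-q) η → p η ≤ C * wNorm (-q) η}

/-- The family of all step-continuous seminorms. -/
def sDualSeminorms : SeminormFamily ℂ SDual StepContinuousSeminorm := fun p => p.1

/-- The inductive limit topology on `s'`, i.e. the finest locally convex topology for which the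
inclusions of all the steps are continuous. -/
instance : TopologicalSpace SDual := sDualSeminorms.moduleFilterBasis.topology

theorem withSeminorms_sDual : WithSeminorms sDualSeminorms := ⟨rfl⟩

instance : IsTopologicalAddGroup SDual := withSeminorms_sDual.topologicalAddGroup
instance : ContinuousSMul ℂ SDual := withSeminorms_sDual.continuousSMul

/-! ### The embeddings `s ↪ ℓ² ↪ s'` -/

theorem sqSummable_L2 (ξ : L2) : SqSummable 0 ξ := by
  rw [sqSummable_iff]
  have : weighted 0 ξ = ξ := by funext j; simp [weighted]
  rw [this]
  exact ξ.2

theorem wNorm_L2 (ξ : L2) : wNorm 0 ξ = ‖ξ‖ := by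
  rw [wNorm_eq_norm _ _ (sqSummable_L2 ξ)]
  congr 1
  exact Subtype.ext (by funext j; simp [weightedL2, weighted])

theorem memLp_SSpace (ξ : SSpace) : Memℓp (ξ : ℕ → ℂ) 2 := by
  have := (sqSummable_iff 0 ξ).1 (by simpa using ξ.2 0)
  have h : weighted 0 ξ = ξ := by funext j; simp [weighted]
  rwa [h] at this

/-- The inclusion of `s` into `ℓ²`. -/
def j₁ : SSpace →L[ℂ] L2 where
  toFun ξ := ⟨ξ.1, memLp_SSpace ξ⟩
  map_add' _ _ := rfl
  map_smul' _ _ := rfl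
  cont := by
    let g : SSpace →ₗ[ℂ] L2 :=
      { toFun := fun ξ => ⟨ξ.1, memLp_SSpace ξ⟩
        map_add' := fun _ _ => rfl
        map_smul' := fun _ _ => rfl }
    refine WithSeminorms.continuous_normedSpace_rng (p := sNorm) L2 withSeminorms_sNorm g
      ⟨{0}, 1, fun ξ => ?_⟩
    simp only [Finset.sup_singleton, one_smul]
    exact (wNorm_L2 (g ξ)).symm.le

/-- The inclusion of `ℓ²` into `s'`. -/
def j₂ : L2 →L[ℂ] SDual where
  toFun ξ := ⟨ξ, 0, by simpa using sqSummable_L2 ξ⟩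
  map_add' _ _ := rfl
  map_smul' _ _ := rfl
  cont := by
    let g : L2 →ₗ[ℂ] SDual :=
      { toFun := fun ξ => ⟨ξ, 0, by simpa using sqSummable_L2 ξ⟩
        map_add' := fun _ _ => rfl
        map_smul' := fun _ _ => rfl }
    refine WithSeminorms.continuous_normedSpace_dom (q := sDualSeminorms) L2 withSeminorms_sDual g
      fun p => ?_
    obtain ⟨C, hC⟩ := p.2 0
    refine ⟨⟨max C 0, le_max_right _ _⟩, fun ξ => ?_⟩
    have hz : (-((0 : ℕ) : ℤ)) = 0 := by simp
    rw [hz] at hC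
    have h := hC (g ξ) (sqSummable_L2 ξ)
    have h2 : wNorm 0 (g ξ) = ‖ξ‖ := wNorm_L2 ξ
    rw [h2] at h
    exact h.trans (mul_le_mul_of_nonneg_right (le_max_left _ _) (norm_nonneg _))

/-! ### The algebra `L(s', s)` of smooth operators -/

/-- The space `L(s', s)` of continuous linear operators from `s'` to `s`, with the topology
of uniform convergence on bounded subsets of `s'` (the default topology on `→L`). -/
abbrev SmoothOp : Type := SDual →L[ℂ] SSpace

/-- A linear map `s' → s` is continuous as soon as it is bounded from each step of `s'` to each of
the normed spaces defining `s`. -/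
theorem continuous_of_bounds (g : SDual →ₗ[ℂ] SSpace)
    (h : ∀ q r : ℕ, ∃ C : ℝ, ∀ η : SDual, SqSummable (-r) η →
      wNorm q (g η) ≤ C * wNorm (-r) η) : Continuous g := by
  refine WithSeminorms.continuous_of_continuous_comp withSeminorms_sNorm g fun q => ?_
  exact withSeminorms_sDual.continuous_seminorm
    (⟨(sNorm q).comp g, fun r => h q r⟩ : StepContinuousSeminorm)

/-- Conversely, continuous operators satisfy these bounds. -/
theorem exists_bound (x : SmoothOp) (q r : ℕ) : ∃ C : ℝ, 0 ≤ C ∧ ∀ η : SDual,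
    SqSummable (-r) η → wNorm q (x η) ≤ C * wNorm (-r) η := by
  have hc : Continuous ((sNorm q).comp (x : SDual →ₗ[ℂ] SSpace)) :=
    (withSeminorms_sNorm.continuous_seminorm q).comp x.continuous
  obtain ⟨s, C, -, hC⟩ := Seminorm.bound_of_continuous withSeminorms_sDual _ hc
  have hs : ∀ s : Finset StepContinuousSeminorm, ∃ D : ℝ, 0 ≤ D ∧ ∀ η : SDual,
      SqSummable (-r) η → (s.sup sDualSeminorms) η ≤ D * wNorm (-r) η := by
    classical
    intro s
    induction s using Finset.induction_on with
    | empty => exact ⟨0, le_rfl, fun η _ => by simp⟩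
    | insert p s _ ih =>
      obtain ⟨D, hD, h⟩ := ih
      obtain ⟨D', h'⟩ := p.2 r
      refine ⟨max D D', hD.trans (le_max_left _ _), fun η hη => ?_⟩
      rw [Finset.sup_insert]
      refine max_le ?_ ?_
      · exact (h' η hη).trans (mul_le_mul_of_nonneg_right (le_max_right _ _) (wNorm_nonneg _ _))
      · exact (h η hη).trans (mul_le_mul_of_nonneg_right (le_max_left _ _) (wNorm_nonneg _ _))
  obtain ⟨D, hD, h⟩ := hs s
  refine ⟨C * D, by positivity, fun η hη => ?_⟩
  have h1 : wNorm q (x η) ≤ C * (s.sup sDualSeminorms) η := hC η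
  rw [mul_assoc]
  exact h1.trans (mul_le_mul_of_nonneg_left (h η hη) C.2)

/-- The embedding `ι : L(s', s) → L(ℓ²)`, `ι x = j₁ ∘ x ∘ j₂`. -/
def iota (x : SmoothOp) : L2 →L[ℂ] L2 := (j₁.comp x).comp j₂

/-- The unit vector `e_k` in `s'`. -/
def unitSDual (k : ℕ) : SDual := j₂ (lp.single 2 k (1 : ℂ))

theorem unitSDual_apply (k : ℕ) : (unitSDual k : ℕ → ℂ) = Pi.single k (1 : ℂ) := by
  funext i
  exact lp.single_apply (E := fun _ : ℕ => ℂ) 2 k (1 : ℂ) i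

theorem hasSum_unit (t : ℤ) (k : ℕ) :
    HasSum (fun j : ℕ => ‖(unitSDual k : ℕ → ℂ) j‖ ^ 2 * ((j : ℝ) + 1) ^ (2 * t))
      (((k : ℝ) + 1) ^ (2 * t)) := by
  rw [unitSDual_apply]
  convert hasSum_single (f := fun j : ℕ => ‖(Pi.single k (1 : ℂ) : ℕ → ℂ) j‖ ^ 2 *
    ((j : ℝ) + 1) ^ (2 * t)) k (fun j hj => by simp [Pi.single_eq_of_ne hj]) using 1
  simp

theorem wNorm_unit (t : ℤ) (k : ℕ) : wNorm t (unitSDual k) = ((k : ℝ) + 1) ^ t := by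
  rw [wNorm, (hasSum_unit t k).tsum_eq]
  have h2 : ((k : ℝ) + 1) ^ (2 * t) = (((k : ℝ) + 1) ^ t) ^ 2 := by
    rw [mul_comm, zpow_mul]; norm_cast
  rw [h2, Real.sqrt_sq (by positivity)]

/-- The coordinates `⟨η, x e_j⟩` of `x* η` are rapidly decreasing, with bounds that are uniform on
the unit ball of each step of `s'`. -/
theorem adjoint_bounds (x : SmoothOp) (q r : ℕ) : ∃ C : ℝ, ∀ η : SDual, SqSummable (-r) η →
    SqSummable q (fun j => pairing η (x (unitSDual j))) ∧
      wNorm q (fun j => pairing η (x (unitSDual j))) ≤ C * wNorm (-r) η := by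
  obtain ⟨C, hC, h⟩ := exists_bound x r (q + 1)
  have hs : Summable fun j : ℕ => 1 / ((j : ℝ) + 1) ^ 2 := by
    have := (summable_nat_add_iff 1).2 (Real.summable_one_div_nat_pow.2 (by norm_num : 1 < 2))
    simpa using this
  have hb : ∀ η : SDual, SqSummable (-r) η → ∀ j : ℕ,
      ‖pairing η (x (unitSDual j))‖ ^ 2 * ((j : ℝ) + 1) ^ (2 * (q : ℤ)) ≤
        (C * wNorm (-r) η) ^ 2 * (1 / ((j : ℝ) + 1) ^ 2) := by
    intro η hη j
    have hj : (0 : ℝ) < (j : ℝ) + 1 := by positivity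
    have h1 := norm_pairing_le hη ((x (unitSDual j)).2 r)
    have h2 := h (unitSDual j) (hasSum_unit _ j).summable
    rw [wNorm_unit] at h2
    have h3 : ‖pairing η (x (unitSDual j))‖ ≤
        (C * wNorm (-r) η) * ((j : ℝ) + 1) ^ (-((q + 1 : ℕ) : ℤ)) := by
      refine h1.trans ((mul_le_mul_of_nonneg_left h2 (wNorm_nonneg _ _)).trans (le_of_eq ?_))
      ring
    have h4 : ‖pairing η (x (unitSDual j))‖ ^ 2 ≤
        ((C * wNorm (-r) η) * ((j : ℝ) + 1) ^ (-((q + 1 : ℕ) : ℤ))) ^ 2 :=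
      pow_le_pow_left₀ (norm_nonneg _) h3 2
    refine (mul_le_mul_of_nonneg_right h4 (by positivity)).trans (le_of_eq ?_)
    rw [mul_pow, mul_assoc]
    congr 1
    rw [← zpow_natCast, ← zpow_mul, ← zpow_add₀ hj.ne', one_div, ← zpow_natCast, ← zpow_neg]
    congr 1
    push_cast
    ring
  refine ⟨C * √(∑' j : ℕ, 1 / ((j : ℝ) + 1) ^ 2), fun η hη => ?_⟩
  have hsum : SqSummable q (fun j => pairing η (x (unitSDual j))) :=
    Summable.of_nonneg_of_le (fun j => by positivity) (hb η hη) (hs.mul_left _)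
  refine ⟨hsum, ?_⟩
  have h5 := Real.sqrt_le_sqrt (Summable.tsum_le_tsum (hb η hη) hsum (hs.mul_left _))
  rw [tsum_mul_left, Real.sqrt_mul (by positivity),
    Real.sqrt_sq (mul_nonneg hC (wNorm_nonneg _ _))] at h5
  refine le_trans h5 (le_of_eq ?_)
  ring

theorem pairing_add_left (η θ : SDual) (ξ : SSpace) :
    pairing (η + θ : SDual) ξ = pairing η ξ + pairing θ ξ := by
  obtain ⟨q, hq⟩ := η.2
  obtain ⟨r, hr⟩ := θ.2
  rw [pairing, pairing, pairing, ← Summable.tsum_add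
    (summable_pairing hq (ξ.2 q)) (summable_pairing hr (ξ.2 r))]
  exact tsum_congr fun i => add_mul _ _ _

theorem pairing_smul_left (c : ℂ) (η ξ : ℕ → ℂ) : pairing (c • η) ξ = c * pairing η ξ := by
  rw [pairing, pairing, ← tsum_mul_left]
  exact tsum_congr fun i => mul_assoc _ _ _

/-- The adjoint of a smooth operator, `(x* η)_j = ⟨η, x e_j⟩`, as a linear map. -/
def adjointLin (x : SmoothOp) : SDual →ₗ[ℂ] SSpace where
  toFun η := ⟨fun j => pairing η (x (unitSDual j)), fun q => by
    obtain ⟨r, hr⟩ := η.2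
    obtain ⟨C, hC⟩ := adjoint_bounds x q r
    exact (hC η hr).1⟩
  map_add' η θ := Subtype.ext (funext fun j => pairing_add_left η θ _)
  map_smul' c η := Subtype.ext (funext fun j => pairing_smul_left c η _)

/-- The involution of `L(s', s)`; see `iota_star` for its identification with the Hilbert space
adjoint. -/
instance : Star SmoothOp where
  star x := ⟨adjointLin x, continuous_of_bounds _ fun q r =>
    (adjoint_bounds x q r).imp fun _ h η hη => (h η hη).2⟩

/-- `x y = x ∘ j ∘ y` with `j = j₂ ∘ j₁`. -/
instance : Mul SmoothOp where
  mul x y := x.comp ((j₂.comp j₁).comp y)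

theorem mul_def (x y : SmoothOp) : x * y = x.comp ((j₂.comp j₁).comp y) := rfl

theorem iota_mul (x y : SmoothOp) : iota (x * y) = (iota x).comp (iota y) := rfl

theorem iota_star (x : SmoothOp) : iota (star x) = ContinuousLinearMap.adjoint (iota x) := by
  ext η j
  have h : (ContinuousLinearMap.adjoint (iota x) η : ℕ → ℂ) j =
      inner ℂ (lp.single 2 j (1 : ℂ) : L2) (ContinuousLinearMap.adjoint (iota x) η) := by
    rw [lp.inner_single_left]; simp
  rw [h, ContinuousLinearMap.adjoint_inner_right, lp.inner_eq_tsum]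
  change pairing (j₂ η) (x (unitSDual j)) = _
  exact tsum_congr fun i => rfl

/-- The ring structure: pointwise addition and the product defined above. -/
instance : NonUnitalRing SmoothOp :=
  { (inferInstance : AddCommGroup SmoothOp) with
    mul := fun x y => x * y
    left_distrib := fun x y z => by simp only [mul_def, ContinuousLinearMap.comp_add]
    right_distrib := fun x y z => by simp only [mul_def, ContinuousLinearMap.add_comp]
    zero_mul := fun x => by simp only [mul_def, ContinuousLinearMap.zero_comp]
    mul_zero := fun x => by simp only [mul_def, ContinuousLinearMap.comp_zero]
    mul_assoc := fun _ _ _ => rfl }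

/-! ### Rank one operators, orthonormal sequences -/

/-- The operator `⟨·, f⟩ f`, i.e. `η ↦ ⟨η, f⟩ f`. -/
def rankOne (f : SSpace) : SmoothOp where
  toFun η := pairing η f • f
  map_add' η θ := by
    rw [pairing_add_left, add_smul]
  map_smul' c η := by
    have h : pairing (c • η : SDual) f = c * pairing η f := pairing_smul_left c η f
    rw [h, mul_smul]; rfl
  cont := by
    let g : SDual →ₗ[ℂ] SSpace :=
      { toFun := fun η => pairing η f • f
        map_add' := fun η θ => by rw [pairing_add_left, add_smul]
        map_smul' := fun c η => by
          have h : pairing (c • η : SDual) f = c * pairing η f := pairing_smul_left c η f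
          rw [h, mul_smul]; rfl }
    refine continuous_of_bounds g fun q r => ⟨wNorm r f * wNorm q f, fun η hη => ?_⟩
    have h1 : wNorm q (g η) = ‖pairing η f‖ * wNorm q f := wNorm_smul q (pairing η f) f
    rw [h1]
    refine (mul_le_mul_of_nonneg_right (norm_pairing_le hη (f.2 r)) (wNorm_nonneg _ _)).trans
      (le_of_eq ?_)
    ring

/-- The sequence `(f_k)` in `s` is orthonormal (with respect to the scalar product of `ℓ²`). -/
def IsOrthonormalSeq (f : ℕ → SSpace) : Prop := Orthonormal ℂ fun k => j₁ (f k)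

/-- The operators `∑_{j ∈ N_k} ⟨·, f_j⟩ f_j`. -/
def blockProj (f : ℕ → SSpace) (N : ℕ → Finset ℕ) (k : ℕ) : SmoothOp :=
  ∑ j ∈ N k, rankOne (f j)

/-! ### Subalgebras of `L(s', s)` and their canonical bases -/

/-- `P` is a nonzero minimal projection in `E`: a nonzero self-adjoint idempotent of `E` such that
the only self-adjoint idempotents `Q ≤ P` of `E` are `0` and `P`. -/
structure IsMinimalProjection (E : NonUnitalStarSubalgebra ℂ SmoothOp) (P : SmoothOp) : Prop where
  mem : P ∈ E
  isStarProjection : IsStarProjection P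
  ne_zero : P ≠ 0
  minimal : ∀ Q ∈ E, IsStarProjection Q → Q * P = Q → P * Q = Q → Q = 0 ∨ Q = P

/-- The sequence `P` enumerates, without repetition, all nonzero minimal projections in `E`. -/
structure IsCanonicalBasis (E : NonUnitalStarSubalgebra ℂ SmoothOp) (P : ℕ → SmoothOp) :
    Prop where
  injective : Function.Injective P
  range_eq : Set.range P = {Q | IsMinimalProjection E Q}

/-- The sequence `P` is a Schauder basis of `E`: it lies in `E` and each `x ∈ E` has a unique
expansion `x = ∑ c_k P_k`, convergent in the topology of `L(s', s)`. -/
structure IsSchauderBasis (E : NonUnitalStarSubalgebra ℂ SmoothOp) (P : ℕ → SmoothOp) :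
    Prop where
  mem : ∀ k, P k ∈ E
  expansion : ∀ x ∈ E, ∃! c : ℕ → ℂ,
    Filter.Tendsto (fun n => ∑ k ∈ Finset.range n, c k • P k) Filter.atTop (nhds x)

/-- `E` is an infinite-dimensional closed commutative `*`-subalgebra of `L(s', s)`. -/
structure IsInfDimClosedComm (E : NonUnitalStarSubalgebra ℂ SmoothOp) : Prop where
  infinite_dimensional : ¬ FiniteDimensional ℂ E
  isClosed : IsClosed (E : Set SmoothOp)
  comm : ∀ x ∈ E, ∀ y ∈ E, x * y = y * x

/-! ### Köthe algebras -/

/-- A Köthe matrix `(a_{j,q})`. -/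
structure KotheMatrix where
  entry : ℕ → ℕ → ℝ
  nonneg : ∀ j q, 0 ≤ entry j q
  exists_pos : ∀ j, ∃ q, 0 < entry j q
  mono : ∀ j q, entry j q ≤ entry j (q + 1)

/-- The sequences `ξ` with `sup_j |ξ_j| a_{j,q} < ∞` for all `q`. -/
def kotheSubmodule (A : KotheMatrix) : Submodule ℂ (ℕ → ℂ) where
  carrier := {ξ | ∀ q, BddAbove (Set.range fun j => ‖ξ j‖ * A.entry j q)}
  zero_mem' := fun q => ⟨0, by rintro _ ⟨j, rfl⟩; simp⟩
  add_mem' := by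
    intro ξ η hξ hη q
    obtain ⟨C, hC⟩ := hξ q
    obtain ⟨D, hD⟩ := hη q
    refine ⟨C + D, ?_⟩
    rintro _ ⟨j, rfl⟩
    have h1 := hC ⟨j, rfl⟩
    have h2 := hD ⟨j, rfl⟩
    refine (mul_le_mul_of_nonneg_right (norm_add_le (ξ j) (η j)) (A.nonneg j q)).trans ?_
    rw [add_mul]
    exact add_le_add h1 h2
  smul_mem' := by
    intro c ξ hξ q
    obtain ⟨C, hC⟩ := hξ q
    refine ⟨‖c‖ * C, ?_⟩
    rintro _ ⟨j, rfl⟩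
    have h1 := hC ⟨j, rfl⟩
    simp only [Pi.smul_apply, smul_eq_mul, norm_mul, mul_assoc]
    exact mul_le_mul_of_nonneg_left h1 (norm_nonneg c)

/-- The Köthe space `λ^∞(A)`. -/
def KotheSpace (A : KotheMatrix) : Type := kotheSubmodule A

instance (A : KotheMatrix) : AddCommGroup (KotheSpace A) :=
  inferInstanceAs (AddCommGroup (kotheSubmodule A))
instance (A : KotheMatrix) : Module ℂ (KotheSpace A) :=
  inferInstanceAs (Module ℂ (kotheSubmodule A))
instance (A : KotheMatrix) : CoeFun (KotheSpace A) (fun _ => ℕ → ℂ) := ⟨fun ξ => ξ.1⟩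

/-- The seminorms `|ξ|_{∞,q} = sup_j |ξ_j| a_{j,q}` on `λ^∞(A)`. -/
def kotheSeminorm (A : KotheMatrix) : SeminormFamily ℂ (KotheSpace A) ℕ := fun q =>
  Seminorm.of (fun ξ => ⨆ j, ‖(ξ : ℕ → ℂ) j‖ * A.entry j q)
    (fun ξ η => by
      refine ciSup_le fun j => ?_
      refine (mul_le_mul_of_nonneg_right (norm_add_le (ξ.1 j) (η.1 j)) (A.nonneg j q)).trans ?_
      rw [add_mul]
      exact add_le_add (le_ciSup (ξ.2 q) j) (le_ciSup (η.2 q) j))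
    (fun c ξ => by
      rw [Real.mul_iSup_of_nonneg (norm_nonneg c)]
      refine iSup_congr fun j => ?_
      rw [← mul_assoc, ← norm_mul]
      rfl)

instance (A : KotheMatrix) : TopologicalSpace (KotheSpace A) :=
  (kotheSeminorm A).moduleFilterBasis.topology

theorem withSeminorms_kothe (A : KotheMatrix) : WithSeminorms (kotheSeminorm A) := ⟨rfl⟩

/-- The Köthe space `λ^∞(A)` is closed under coordinatewise multiplication. -/
class KotheMatrix.IsAlgebra (A : KotheMatrix) : Prop where
  mul_mem : ∀ ξ ∈ kotheSubmodule A, ∀ η ∈ kotheSubmodule A, ξ * η ∈ kotheSubmodule A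

/-- This is the case for matrices with entries `≥ 1`. -/
theorem KotheMatrix.isAlgebra_of_one_le (A : KotheMatrix) (h : ∀ j q, 1 ≤ A.entry j q) :
    A.IsAlgebra where
  mul_mem := by
    intro ξ hξ η hη q
    obtain ⟨C, hC⟩ := hξ q
    obtain ⟨D, hD⟩ := hη q
    refine ⟨C * D, ?_⟩
    rintro _ ⟨j, rfl⟩
    have h1 : ‖ξ j‖ * A.entry j q ≤ C := hC ⟨j, rfl⟩
    have h2 : ‖η j‖ * A.entry j q ≤ D := hD ⟨j, rfl⟩
    have h3 : ‖ξ j‖ ≤ C := (le_mul_of_one_le_right (norm_nonneg _) (h j q)).trans h1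
    simp only [Pi.mul_apply, norm_mul, mul_assoc]
    exact mul_le_mul h3 h2 (mul_nonneg (norm_nonneg _) (A.nonneg j q))
      ((norm_nonneg _).trans h3)

/-- Coordinatewise multiplication on a Köthe algebra. -/
instance (A : KotheMatrix) [A.IsAlgebra] : Mul (KotheSpace A) where
  mul ξ η := ⟨ξ.1 * η.1, KotheMatrix.IsAlgebra.mul_mem ξ.1 ξ.2 η.1 η.2⟩

/-- Coordinatewise complex conjugation. -/
instance (A : KotheMatrix) : Star (KotheSpace A) where
  star ξ := ⟨fun j => conj (ξ.1 j), fun q => by simpa using ξ.2 q⟩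

/-- The unit vector `e_k` in `λ^∞(A)`. -/
def kotheUnit (A : KotheMatrix) (k : ℕ) : KotheSpace A :=
  ⟨Pi.single k 1, fun q => ⟨A.entry k q, by
    rintro _ ⟨j, rfl⟩
    rcases eq_or_ne j k with rfl | hj
    · simp
    · simpa [Pi.single_eq_of_ne hj] using A.nonneg k q⟩⟩

theorem one_le_sNorm {f : ℕ → SSpace} (hf : IsOrthonormalSeq f) (j q : ℕ) :
    1 ≤ sNorm q (f j) := by
  have h1 : wNorm 0 (f j) = 1 := (wNorm_L2 (j₁ (f j))).trans (hf.1 j)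
  have h2 : wNorm 0 (f j) ≤ wNorm q (f j) := wNorm_mono (by positivity) ((f j).2 q)
  rw [h1] at h2
  exact h2

theorem sNorm_mono (ξ : SSpace) (q : ℕ) : sNorm q ξ ≤ sNorm (q + 1) ξ :=
  wNorm_mono (by push_cast; omega) (ξ.2 (q + 1))

theorem one_le_max {f : ℕ → SSpace} (hf : IsOrthonormalSeq f) {N : ℕ → Finset ℕ}
    (hN : ∀ k, (N k).Nonempty) (k q : ℕ) : 1 ≤ (N k).sup' (hN k) fun j => sNorm q (f j) := by
  obtain ⟨j, hj⟩ := hN k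
  exact (one_le_sNorm hf j q).trans (Finset.le_sup' (fun j => sNorm q (f j)) hj)

/-- The Köthe matrix `(max_{j ∈ N_k} |f_j|_q)_{k,q}`. -/
def maxMatrix (f : ℕ → SSpace) (hf : IsOrthonormalSeq f) (N : ℕ → Finset ℕ)
    (hN : ∀ k, (N k).Nonempty) : KotheMatrix where
  entry k q := (N k).sup' (hN k) fun j => sNorm q (f j)
  nonneg k q := zero_le_one.trans (one_le_max hf hN k q)
  exists_pos k := ⟨0, zero_lt_one.trans_le (one_le_max hf hN k 0)⟩
  mono _ q := Finset.sup'_mono_fun fun j _ => sNorm_mono (f j) q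

instance (f : ℕ → SSpace) (hf : IsOrthonormalSeq f) (N : ℕ → Finset ℕ)
    (hN : ∀ k, (N k).Nonempty) : (maxMatrix f hf N hN).IsAlgebra :=
  KotheMatrix.isAlgebra_of_one_le _ fun k q => one_le_max hf hN k q

/-- There is an isomorphism of Fréchet `*`-algebras `E ≅ λ^∞(A)`, i.e. a bijective
`*`-homomorphism that is a homeomorphism, which sends `P_k` to `e_k` for all `k`. -/
def IsoVia (E : NonUnitalStarSubalgebra ℂ SmoothOp) (P : ℕ → SmoothOp) (A : KotheMatrix)
    [A.IsAlgebra] : Prop :=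
  ∃ Φ : E ≃⋆ₐ[ℂ] KotheSpace A, IsHomeomorph Φ ∧
    ∀ k, ∃ h : P k ∈ E, Φ ⟨P k, h⟩ = kotheUnit A k

end SmoothOperators

end

/-!
Write `D` for the multiplication of the `j`-th entry by `j`. The topology of `L(s', s)` is given by
the operator norms of `D^q x D^q` on `ℓ²`, and `L(s', s)` is complete.

Let `(f_j)` be orthonormal in `s` and `P_k = ∑_{j ∈ N_k} ⟨·, f_j⟩ f_j`. Cauchy–Schwarz gives
`|f_j|_q ^ 2 ≤ |f_j|_{4q+4} |f_j|'_1 ^ 2`, and `∑_j |f_j|'_1 ^ 2 ≤ ∑_i i⁻²` by Bessel's inequality,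
so `∑_k |c_k| ‖D^q P_k D^q‖` is at most a constant times `sup_k |c_k| max_{j ∈ N_k} |f_j|_{4q+4}`,
and `c ↦ ∑ c_k P_k` is continuous from `λ^∞(max_{j ∈ N_k} |f_j|_q)` to `L(s', s)`. Conversely, if
`x P_k = c_k P_k` and `j ∈ N_k`, then `x f_j = c_k f_j`, hence `|c_k| |f_j|_q ≤ ‖D^q x D^q‖`: the
coefficients depend continuously on `x`.

Now let `E` be closed and commutative. For a positive `x ∈ E` of norm one on `ℓ²`, the operator `x`
is compact, so `x ^ n` converges in norm to the projection `Q ≠ 0` onto its fixed points; since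
`x x ^ n x → x Q x = Q` even in `L(s', s)`, `E` contains `Q`. Applied to multiples of `z* z`, this
shows that a nonzero `z ∈ E` has a nonzero product with some minimal projection of `E`, and that
`z* z P ∈ ℂ P` for `P` minimal, hence `z P ∈ ℂ P` by polarization. An element of `E` is therefore
determined by its coefficients, so `E` is the range of `c ↦ ∑ c_k P_k`.
-/

noncomputable section

namespace SmoothOperators

open Filter Topology
open scoped InnerProductSpace

theorem weighted_weighted_neg (t : ℤ) (ξ : ℕ → ℂ) : weighted t (weighted (-t) ξ) = ξ := by
  funext j
  have hj : ((j : ℂ) + 1) ^ t ≠ 0 := zpow_ne_zero t (Nat.cast_add_one_ne_zero j)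
  simp [weighted, hj]

theorem weighted_neg_weighted (t : ℤ) (ξ : ℕ → ℂ) : weighted (-t) (weighted t ξ) = ξ := by
  simpa only [neg_neg] using weighted_weighted_neg (-t) ξ

theorem weighted_zero_left (ξ : ℕ → ℂ) : weighted 0 ξ = ξ := by
  funext j
  simp [weighted]

theorem sqSummable_neg_weighted (t : ℤ) (ξ : L2) : SqSummable (-t) (weighted t ξ) := by
  rw [sqSummable_iff, weighted_neg_weighted]
  exact ξ.2

theorem weightedL2_neg_weighted (t : ℤ) (ξ : L2) :
    weightedL2 (-t) (weighted t ξ) (sqSummable_neg_weighted t ξ) = ξ :=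
  Subtype.ext (weighted_neg_weighted t ξ)

theorem wNorm_neg_weighted (t : ℤ) (ξ : L2) : wNorm (-t) (weighted t ξ) = ‖ξ‖ := by
  rw [wNorm_eq_norm _ _ (sqSummable_neg_weighted t ξ), weightedL2_neg_weighted]

/-- The linear map underlying `toWeighted`. -/
def toWeightedLin (q : ℕ) : SSpace →ₗ[ℂ] L2 where
  toFun ξ := weightedL2 q ξ (ξ.2 q)
  map_add' ξ η := Subtype.ext (weighted_add q ξ η)
  map_smul' c ξ := Subtype.ext (weighted_smul q c ξ)

theorem norm_toWeightedLin (q : ℕ) (ξ : SSpace) : ‖toWeightedLin q ξ‖ = sNorm q ξ :=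
  (wNorm_eq_norm _ _ (ξ.2 q)).symm

/-- The map `ξ ↦ ((j + 1) ^ q ξ_j)_j` from `s` to `ℓ²`, isometric for the norm `|·|_q`. -/
def toWeighted (q : ℕ) : SSpace →L[ℂ] L2 where
  toLinearMap := toWeightedLin q
  cont := WithSeminorms.continuous_normedSpace_rng (p := sNorm) L2 withSeminorms_sNorm _
    ⟨{q}, 1, fun ξ => by
      rw [Finset.sup_singleton, one_smul]
      exact (norm_toWeightedLin q ξ).le⟩

theorem norm_toWeighted (q : ℕ) (ξ : SSpace) : ‖toWeighted q ξ‖ = sNorm q ξ :=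
  norm_toWeightedLin q ξ

/-- The linear map underlying `ofWeighted`. -/
def ofWeightedLin (q : ℕ) : L2 →ₗ[ℂ] SDual where
  toFun ξ := ⟨weighted q ξ, q, sqSummable_neg_weighted q ξ⟩
  map_add' ξ η := Subtype.ext (weighted_add q ξ η)
  map_smul' c ξ := Subtype.ext (weighted_smul q c ξ)

/-- The map `ξ ↦ ((j + 1) ^ q ξ_j)_j` from `ℓ²` to `s'`; it is an isometry onto the step of `s'`
with the norm `|·|'_q`. -/
def ofWeighted (q : ℕ) : L2 →L[ℂ] SDual where
  toLinearMap := ofWeightedLin q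
  cont := by
    refine WithSeminorms.continuous_normedSpace_dom (q := sDualSeminorms) L2 withSeminorms_sDual _
      fun p => ?_
    obtain ⟨C, hC⟩ := p.2 q
    refine ⟨C.toNNReal, fun ξ => ?_⟩
    calc p.1 (ofWeightedLin q ξ) ≤ C * wNorm (-q) (weighted q ξ) :=
          hC (ofWeightedLin q ξ) (sqSummable_neg_weighted q ξ)
      _ = C * ‖ξ‖ := by rw [wNorm_neg_weighted]
      _ ≤ C.toNNReal * ‖ξ‖ := mul_le_mul_of_nonneg_right (Real.le_coe_toNNReal C) (norm_nonneg ξ)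

theorem ofWeighted_weightedL2 (q : ℕ) (η : SDual) (h : SqSummable (-q) η) :
    ofWeighted q (weightedL2 (-q) η h) = η :=
  Subtype.ext (weighted_weighted_neg q η)

theorem ofWeighted_zero (ξ : L2) : ofWeighted 0 ξ = j₂ ξ :=
  Subtype.ext (weighted_zero_left ξ)

theorem toWeighted_zero (ξ : SSpace) : toWeighted 0 ξ = j₁ ξ :=
  Subtype.ext (weighted_zero_left ξ)

theorem j₁_injective : Function.Injective j₁ := fun _ _ h =>
  Subtype.ext (congrArg (fun ζ : L2 => (ζ : ℕ → ℂ)) h)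

instance : T2Space SSpace := T2Space.of_injective_continuous j₁_injective j₁.continuous

/-- The operator `x` on `ℓ²` with both sides multiplied by the weight `(j + 1) ^ q`. Its operator
norm is the norm of `x` as an operator from the step `|·|'_q` of `s'` to `(s, |·|_q)`. -/
def weightedOp (q : ℕ) : SmoothOp →L[ℂ] (L2 →L[ℂ] L2) :=
  (ContinuousLinearMap.postcomp L2 (toWeighted q)).comp
    (ContinuousLinearMap.precomp SSpace (ofWeighted q))

theorem weightedOp_apply (q : ℕ) (x : SmoothOp) (ξ : L2) :
    weightedOp q x ξ = toWeighted q (x (ofWeighted q ξ)) := rfl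

theorem weightedOp_zero (x : SmoothOp) : weightedOp 0 x = iota x := by
  ext1 ξ
  rw [weightedOp_apply, ofWeighted_zero, toWeighted_zero]
  rfl

theorem weightedOp_weightedL2 {q : ℕ} (x : SmoothOp) {η : SDual} (h : SqSummable (-q) η) :
    weightedOp q x (weightedL2 (-q) η h) = toWeighted q (x η) := by
  rw [weightedOp_apply, ofWeighted_weightedL2]

theorem sNorm_apply_le (q : ℕ) (x : SmoothOp) (η : SDual) (h : SqSummable (-q) η) :
    sNorm q (x η) ≤ ‖weightedOp q x‖ * wNorm (-q) η := by
  rw [← norm_toWeighted, ← weightedOp_weightedL2 x h, wNorm_eq_norm _ _ h]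
  exact (weightedOp q x).le_opNorm _

theorem norm_apply_le_wNorm {q : ℕ} {η : ℕ → ℂ} (h : SqSummable (-q) η) (j : ℕ) :
    ‖η j‖ ≤ wNorm (-q) η * ((j : ℝ) + 1) ^ q := by
  have hw : ‖weighted (-q) η j‖ = (((j : ℝ) + 1) ^ q)⁻¹ * ‖η j‖ := by
    rw [weighted, norm_mul, Complex.norm_real, Real.norm_of_nonneg (by positivity), zpow_neg,
      zpow_natCast]
  have hle : ‖weighted (-q) η j‖ ≤ wNorm (-q) η := by
    rw [wNorm_eq_norm _ _ h]
    exact lp.norm_apply_le_norm (by norm_num) (weightedL2 (-q) η h) j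
  rwa [hw, inv_mul_le_iff₀ (by positivity), mul_comm] at hle

theorem summable_inv_succ_sq : Summable fun j : ℕ => 1 / ((j : ℝ) + 1) ^ 2 := by
  simpa using (summable_nat_add_iff 1).2 (Real.summable_one_div_nat_pow.2 one_lt_two)

theorem exists_forall_norm_div_pow_le (j : ℕ → ℕ) (r : ℕ) :
    ∃ C : ℝ, ∀ θ : ℕ → ℂ, SqSummable (-r) θ → ∀ n,
      ‖θ (j n)‖ / ((j n : ℝ) + 1) ^ n ≤ C * wNorm (-r) θ := by
  have hbdd : BddAbove (Set.range fun n => ((j n : ℝ) + 1) ^ r / ((j n : ℝ) + 1) ^ n) := by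
    refine (isBoundedUnder_of_eventually_le (a := 1) ?_).bddAbove_range
    filter_upwards [eventually_ge_atTop r] with n hn
    exact div_le_one_of_le₀ (pow_le_pow_right₀ (by simp) hn) (by positivity)
  obtain ⟨C, hC⟩ := hbdd
  refine ⟨C, fun θ hθ n => ?_⟩
  calc ‖θ (j n)‖ / ((j n : ℝ) + 1) ^ n
      ≤ wNorm (-r) θ * ((j n : ℝ) + 1) ^ r / ((j n : ℝ) + 1) ^ n := by
        gcongr
        exact norm_apply_le_wNorm hθ (j n)
    _ = ((j n : ℝ) + 1) ^ r / ((j n : ℝ) + 1) ^ n * wNorm (-r) θ := by ring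
    _ ≤ C * wNorm (-r) θ := mul_le_mul_of_nonneg_right (hC ⟨n, rfl⟩) (wNorm_nonneg _ _)

theorem bddAbove_range_norm_div_pow (j : ℕ → ℕ) (θ : SDual) :
    BddAbove (Set.range fun n => ‖θ (j n)‖ / ((j n : ℝ) + 1) ^ n) := by
  obtain ⟨r, hr⟩ := θ.2
  obtain ⟨C, hC⟩ := exists_forall_norm_div_pow_le j r
  exact ⟨C * wNorm (-r) θ, Set.forall_mem_range.2 (hC θ hr)⟩

/-- The seminorm `θ ↦ sup_n |θ_{j_n}| / (j_n + 1) ^ n` on `s'`. It is finite because `θ` grows at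
most polynomially, with an exponent that is smaller than `n` for all but finitely many `n`. -/
def growthSeminorm (j : ℕ → ℕ) : StepContinuousSeminorm :=
  ⟨Seminorm.of (fun θ => ⨆ n, ‖θ (j n)‖ / ((j n : ℝ) + 1) ^ n)
    (fun θ ζ => ciSup_le fun n => by
      refine le_trans ?_ (add_le_add (le_ciSup (bddAbove_range_norm_div_pow j θ) n)
        (le_ciSup (bddAbove_range_norm_div_pow j ζ) n))
      rw [← add_div]
      exact div_le_div_of_nonneg_right (norm_add_le _ _) (by positivity))
    (fun c θ => by
      rw [Real.mul_iSup_of_nonneg (norm_nonneg c)]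
      refine iSup_congr fun n => ?_
      rw [← mul_div_assoc, ← norm_mul]
      rfl),
    fun r => (exists_forall_norm_div_pow_le j r).imp fun _ h θ hθ => ciSup_le (h θ hθ)⟩

theorem exists_forall_norm_le_mul_pow {S : Set SDual} (hS : Bornology.IsVonNBounded ℂ S) :
    ∃ n : ℕ, ∀ η ∈ S, ∀ j : ℕ, ‖η j‖ ≤ n * ((j : ℝ) + 1) ^ n := by
  by_contra! hcon
  choose η hη j hj using hcon
  obtain ⟨R, -, hR⟩ := withSeminorms_sDual.isVonNBounded_iff_seminorm_bounded.1 hS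
    (growthSeminorm j)
  obtain ⟨n, hn⟩ := exists_nat_gt R
  have hlt : (n : ℝ) < ‖(η n) (j n)‖ / ((j n : ℝ) + 1) ^ n :=
    (lt_div_iff₀ (by positivity)).2 (hj n)
  have hle : ‖(η n) (j n)‖ / ((j n : ℝ) + 1) ^ n ≤ sDualSeminorms (growthSeminorm j) (η n) :=
    le_ciSup (bddAbove_range_norm_div_pow j (η n)) n
  exact (hn.trans (hlt.trans_le (hle.trans (hR _ (hη n)).le))).false

theorem sqSummable_and_wNorm_le_of_norm_le {n : ℕ} {C : ℝ} {η : ℕ → ℂ} (hC : 0 ≤ C)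
    (h : ∀ j : ℕ, ‖η j‖ ≤ C * ((j : ℝ) + 1) ^ n) :
    SqSummable (-(n + 1 : ℕ)) η ∧
      wNorm (-(n + 1 : ℕ)) η ≤ C * √(∑' j : ℕ, 1 / ((j : ℝ) + 1) ^ 2) := by
  have hle : ∀ j : ℕ, ‖η j‖ ^ 2 * ((j : ℝ) + 1) ^ (2 * (-((n + 1 : ℕ) : ℤ))) ≤
      C ^ 2 * (1 / ((j : ℝ) + 1) ^ 2) := by
    intro j
    have hpow : ((j : ℝ) + 1) ^ (2 * (-((n + 1 : ℕ) : ℤ))) =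
        ((((j : ℝ) + 1) ^ n) ^ 2 * ((j : ℝ) + 1) ^ 2)⁻¹ := by
      rw [← mul_pow, ← pow_succ, mul_neg, zpow_neg, ← pow_mul, mul_comm (n + 1)]
      norm_cast
    calc ‖η j‖ ^ 2 * ((j : ℝ) + 1) ^ (2 * (-((n + 1 : ℕ) : ℤ)))
        ≤ (C * ((j : ℝ) + 1) ^ n) ^ 2 * ((j : ℝ) + 1) ^ (2 * (-((n + 1 : ℕ) : ℤ))) := by
          gcongr
          exact h j
      _ = C ^ 2 * (1 / ((j : ℝ) + 1) ^ 2) := by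
          rw [hpow]
          field_simp
  have hsum : SqSummable (-(n + 1 : ℕ)) η :=
    (summable_inv_succ_sq.mul_left _).of_nonneg_of_le (fun j => by positivity) hle
  refine ⟨hsum, (Real.sqrt_le_sqrt
    (Summable.tsum_le_tsum hle hsum (summable_inv_succ_sq.mul_left _))).trans_eq ?_⟩
  rw [tsum_mul_left, Real.sqrt_mul (sq_nonneg C), Real.sqrt_sq hC]

theorem exists_step_of_isVonNBounded {S : Set SDual} (hS : Bornology.IsVonNBounded ℂ S) :
    ∃ (q : ℕ) (C : ℝ), ∀ η ∈ S, SqSummable (-q) η ∧ wNorm (-q) η ≤ C :=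
  let ⟨n, hn⟩ := exists_forall_norm_le_mul_pow hS
  ⟨n + 1, _, fun η hη => sqSummable_and_wNorm_le_of_norm_le n.cast_nonneg (hn η hη)⟩

theorem nhds_zero_smoothOp_hasBasis :
    (𝓝 (0 : SmoothOp)).HasBasis (fun p : ℕ × ℝ => 0 < p.2)
      fun p => {x | ‖weightedOp p.1 x‖ < p.2} := by
  refine ⟨fun t => ⟨fun ht => ?_, ?_⟩⟩
  · obtain ⟨⟨S, U⟩, ⟨hS, hU⟩, ht⟩ :=
      (ContinuousLinearMap.hasBasis_nhds_zero (𝕜₁ := ℂ) (E := SDual) (F := SSpace)).mem_iff.1 ht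
    obtain ⟨q, C, hq⟩ := exists_step_of_isVonNBounded hS
    obtain ⟨s, ε, hε, hs⟩ := (withSeminorms_sNorm.mem_nhds_iff 0 U).1 hU
    set r := max q (s.sup id)
    refine ⟨(r, ε / (|C| + 1)), by positivity, fun x hx => ht fun η hη => hs ?_⟩
    rw [Seminorm.mem_ball, sub_zero]
    refine Seminorm.finset_sup_apply_lt hε fun i hi => ?_
    have hir : i ≤ r := (Finset.le_sup (f := id) hi).trans (le_max_right _ _)
    have hqr : -(r : ℤ) ≤ -(q : ℤ) := by have := le_max_left q (s.sup id); omega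
    have hηr : wNorm (-r) η ≤ |C| + 1 :=
      (wNorm_mono hqr (hq η hη).1).trans ((hq η hη).2.trans (by linarith [le_abs_self C]))
    calc sNorm i (x η) ≤ sNorm r (x η) := wNorm_mono (by exact_mod_cast hir) ((x η).2 r)
      _ ≤ ‖weightedOp r x‖ * wNorm (-r) η := sNorm_apply_le r x η ((hq η hη).1.mono hqr)
      _ ≤ ‖weightedOp r x‖ * (|C| + 1) := by gcongr
      _ < ε := (lt_div_iff₀ (by positivity)).1 hx
  · rintro ⟨⟨q, ε⟩, hε, ht⟩
    refine mem_of_superset ((isOpen_lt (by fun_prop) continuous_const).mem_nhds ?_) ht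
    simpa only [Set.mem_ofPred_eq, map_zero, norm_zero] using hε

theorem isInducing_weightedOp :
    IsInducing (ContinuousLinearMap.pi weightedOp : SmoothOp →L[ℂ] (ℕ → L2 →L[ℂ] L2)) := by
  rw [IsTopologicalAddGroup.isInducing_iff_nhds_zero]
  refine le_antisymm ?_ ?_
  · have := (ContinuousLinearMap.pi weightedOp).continuous.tendsto (0 : SmoothOp)
    rw [map_zero] at this
    exact this.le_comap
  · refine nhds_zero_smoothOp_hasBasis.ge_iff.2 ?_
    rintro ⟨q, ε⟩ hε
    have hmem : {T : ℕ → L2 →L[ℂ] L2 | ‖T q‖ < ε} ∈ 𝓝 0 :=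
      (isOpen_lt (by fun_prop) continuous_const).mem_nhds (by simpa using hε)
    exact mem_comap.2 ⟨_, hmem, fun x hx => hx⟩

theorem tendsto_smoothOp_iff {α : Type*} {l : Filter α} {x : α → SmoothOp} {y : SmoothOp} :
    Tendsto x l (𝓝 y) ↔ ∀ q, Tendsto (fun a => weightedOp q (x a)) l (𝓝 (weightedOp q y)) :=
  isInducing_weightedOp.tendsto_nhds_iff.trans tendsto_pi_nhds

theorem continuous_smoothOp_iff {α : Type*} [TopologicalSpace α] {x : α → SmoothOp} :
    Continuous x ↔ ∀ q, Continuous fun a => weightedOp q (x a) :=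
  isInducing_weightedOp.continuous_iff.trans continuous_pi_iff

theorem tendsto_sSpace_iff {α : Type*} {l : Filter α} {ξ : α → SSpace} {ξ₀ : SSpace} :
    Tendsto ξ l (𝓝 ξ₀) ↔ ∃ r, ∀ q ≥ r,
      Tendsto (fun a => toWeighted q (ξ a)) l (𝓝 (toWeighted q ξ₀)) := by
  refine ⟨fun h => ⟨0, fun q _ => ((toWeighted q).continuous.tendsto ξ₀).comp h⟩, ?_⟩
  rintro ⟨r, h⟩
  refine (withSeminorms_sNorm.tendsto_nhds _ _).2 fun q ε hε => ?_
  filter_upwards [Metric.tendsto_nhds.1 (h _ (le_max_right q r)) ε hε] with a ha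
  rw [dist_eq_norm, ← map_sub, norm_toWeighted] at ha
  exact (wNorm_mono (by exact_mod_cast le_max_left q r) ((ξ a - ξ₀).2 _)).trans_lt ha

theorem exists_tendsto_of_toWeighted {α : Type*} {l : Filter α} [l.NeBot] {ξ : α → SSpace} {r : ℕ}
    (h : ∀ q ≥ r, ∃ ζ, Tendsto (fun a => toWeighted q (ξ a)) l (𝓝 ζ)) :
    ∃ ξ₀, Tendsto ξ l (𝓝 ξ₀) := by
  choose! ζ hζ using h
  have hcoord : ∀ q ≥ r, ∀ j, Tendsto (fun a => ξ a j) l (𝓝 (weighted (-q) (ζ q) j)) := by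
    intro q hq j
    refine (((lp.evalCLM ℂ (fun _ : ℕ => ℂ) 2 j).continuous.tendsto _).comp (hζ q hq)).const_mul
      ((((j : ℝ) + 1) ^ (-q : ℤ) : ℝ) : ℂ) |>.congr fun a => ?_
    exact congrFun (weighted_neg_weighted q (ξ a)) j
  have heq : ∀ q ≥ r, weighted (-r) (ζ r) = weighted (-q) (ζ q) := fun q hq =>
    funext fun j => tendsto_nhds_unique (hcoord r le_rfl j) (hcoord q hq j)
  let ξ₀ : SSpace := ⟨weighted (-r) (ζ r), fun q => by
    rw [heq _ (le_max_right q r)]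
    refine SqSummable.mono (u := (max q r : ℕ)) (by exact_mod_cast le_max_left q r) ?_
    simpa only [neg_neg] using sqSummable_neg_weighted (-(max q r : ℕ)) (ζ (max q r))⟩
  have hξ₀ : ∀ q ≥ r, toWeighted q ξ₀ = ζ q := fun q hq =>
    Subtype.ext ((congrArg (weighted q) (heq q hq)).trans (weighted_weighted_neg q (ζ q)))
  exact ⟨ξ₀, tendsto_sSpace_iff.2 ⟨r, fun q hq => by rw [hξ₀ q hq]; exact hζ q hq⟩⟩

theorem exists_tendsto_of_weightedOp {α : Type*} {l : Filter α} [l.NeBot] {x : α → SmoothOp}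
    {T : ℕ → L2 →L[ℂ] L2} (h : ∀ q, Tendsto (fun a => weightedOp q (x a)) l (𝓝 (T q))) :
    ∃ y, Tendsto x l (𝓝 y) := by
  have hstep : ∀ (η : SDual) (q : ℕ) (hη : SqSummable (-q) η),
      Tendsto (fun a => toWeighted q (x a η)) l (𝓝 (T q (weightedL2 (-q) η hη))) := by
    intro η q hη
    simp only [← weightedOp_weightedL2 _ hη]
    exact ((ContinuousLinearMap.apply ℂ L2 (weightedL2 (-q) η hη)).continuous.tendsto _).comp (h q)
  have hlim : ∀ η, ∃ ζ, Tendsto (fun a => x a η) l (𝓝 ζ) := by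
    intro η
    obtain ⟨r, hr⟩ := η.2
    exact exists_tendsto_of_toWeighted fun q hq =>
      ⟨_, hstep η q (hr.mono (neg_le_neg (mod_cast hq)))⟩
  choose g hg using hlim
  let G : SDual →ₗ[ℂ] SSpace :=
    linearMapOfTendsto g (fun a => (x a : SDual →ₗ[ℂ] SSpace)) (tendsto_pi_nhds.2 hg)
  have hG : ∀ (η : SDual) (q : ℕ) (hη : SqSummable (-q) η),
      toWeighted q (G η) = T q (weightedL2 (-q) η hη) := fun η q hη =>
    tendsto_nhds_unique (((toWeighted q).continuous.tendsto _).comp (hg η)) (hstep η q hη)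
  have hcont : Continuous G := by
    refine continuous_of_bounds G fun q r => ⟨‖T (max q r)‖, fun η hη => ?_⟩
    have hr : -((max q r : ℕ) : ℤ) ≤ -(r : ℤ) := by omega
    calc wNorm q (G η) ≤ sNorm (max q r) (G η) :=
          wNorm_mono (by exact_mod_cast le_max_left q r) ((G η).2 _)
      _ = ‖T (max q r) (weightedL2 _ η (hη.mono hr))‖ := by rw [← norm_toWeighted, hG]
      _ ≤ ‖T (max q r)‖ * wNorm (-(max q r : ℕ)) η := by
          rw [wNorm_eq_norm _ _ (hη.mono hr)]
          exact (T _).le_opNorm _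
      _ ≤ ‖T (max q r)‖ * wNorm (-r) η :=
          mul_le_mul_of_nonneg_left (wNorm_mono hr hη) (norm_nonneg _)
  refine ⟨⟨G, hcont⟩, tendsto_smoothOp_iff.2 fun q => ?_⟩
  convert h q using 2
  ext1 ξ
  have hξ : SqSummable (-q) (ofWeighted q ξ) := sqSummable_neg_weighted q ξ
  exact (hG (ofWeighted q ξ) q hξ).trans (congrArg (T q) (weightedL2_neg_weighted q ξ))

/-- The embedding `ι` as a homomorphism of `*`-algebras. -/
def iotaHom : SmoothOp →⋆ₙₐ[ℂ] (L2 →L[ℂ] L2) where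
  toFun := iota
  map_smul' c x := by simp only [← weightedOp_zero, map_smul, MonoidHom.id_apply]
  map_zero' := by simp only [← weightedOp_zero, map_zero]
  map_add' x y := by simp only [← weightedOp_zero, map_add]
  map_mul' := iota_mul
  map_star' := iota_star

theorem iotaHom_eq_weightedOp_zero (x : SmoothOp) : iotaHom x = weightedOp 0 x :=
  (weightedOp_zero x).symm

theorem iotaHom_apply (x : SmoothOp) (ξ : L2) : iotaHom x ξ = j₁ (x (j₂ ξ)) := rfl

theorem continuous_iotaHom : Continuous iotaHom :=
  (weightedOp 0).continuous.congr weightedOp_zero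

theorem ofWeighted_single (q i : ℕ) :
    ofWeighted q (lp.single 2 i (1 : ℂ)) =
      ((((i : ℝ) + 1) ^ q : ℝ) : ℂ) • j₂ (lp.single 2 i (1 : ℂ)) := by
  refine Subtype.ext (funext fun l => ?_)
  change weighted q _ l = ((((i : ℝ) + 1) ^ q : ℝ) : ℂ) * (lp.single 2 i (1 : ℂ) : L2) l
  rw [weighted]
  rcases eq_or_ne l i with rfl | h
  · simp only [zpow_natCast]
  · rw [lp.single_apply_ne _ _ _ h, mul_zero, mul_zero]

theorem iotaHom_injective : Function.Injective iotaHom := by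
  intro x y h
  refine isInducing_weightedOp.injective (funext fun q => ?_)
  refine lp.ext_continuousLinearMap (by norm_num) fun i => ?_
  ext1
  change weightedOp q x (lp.single 2 i 1) = weightedOp q y (lp.single 2 i 1)
  have hi : x (j₂ (lp.single 2 i 1)) = y (j₂ (lp.single 2 i 1)) :=
    j₁_injective (congrArg (fun T : L2 →L[ℂ] L2 => T (lp.single 2 i 1)) h)
  simp only [weightedOp_apply, ofWeighted_single, map_smul, hi]

instance : StarRing SmoothOp where
  star_involutive x := iotaHom_injective (by simp only [map_star, star_star])
  star_mul x y := iotaHom_injective (by simp only [map_star, map_mul, star_mul])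
  star_add x y := iotaHom_injective (by simp only [map_star, map_add, star_add])

instance : StarModule ℂ SmoothOp where
  star_smul c x := iotaHom_injective (by simp only [map_star, map_smul, star_smul])

instance : IsScalarTower ℂ SmoothOp SmoothOp where
  smul_assoc _ _ _ := rfl

instance : SMulCommClass ℂ SmoothOp SmoothOp where
  smul_comm c x y := iotaHom_injective (by
    simp only [smul_eq_mul, map_smul, map_mul, mul_smul_comm])

theorem isStarProjection_iotaHom_iff {x : SmoothOp} :
    IsStarProjection (iotaHom x) ↔ IsStarProjection x :=
  ⟨fun h => ⟨iotaHom_injective ((map_mul _ _ _).trans h.isIdempotentElem),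
    iotaHom_injective ((map_star _ _).trans h.isSelfAdjoint)⟩, fun h => h.map iotaHom⟩

section RankOne

theorem pairing_ofWeighted (q : ℕ) (ξ : L2) (f : SSpace) :
    pairing (ofWeighted q ξ) f = ⟪toWeighted q f, ξ⟫_ℂ := by
  rw [lp.inner_eq_tsum]
  refine tsum_congr fun j => ?_
  change weighted q ξ j * conj (f j) = ⟪weighted q f j, ξ j⟫_ℂ
  simp only [weighted, RCLike.inner_apply, map_mul, Complex.conj_ofReal]
  ring

theorem weightedOp_rankOne (q : ℕ) (f : SSpace) :
    weightedOp q (rankOne f) = InnerProductSpace.rankOne ℂ (toWeighted q f) (toWeighted q f) := by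
  ext1 ξ
  change toWeighted q (pairing (ofWeighted q ξ) f • f) = _
  rw [map_smul, pairing_ofWeighted, InnerProductSpace.rankOne_apply]

theorem norm_weightedOp_rankOne (q : ℕ) (f : SSpace) :
    ‖weightedOp q (rankOne f)‖ = sNorm q f ^ 2 := by
  rw [weightedOp_rankOne, InnerProductSpace.norm_rankOne, norm_toWeighted, sq]

theorem iotaHom_rankOne (f : SSpace) :
    iotaHom (rankOne f) = InnerProductSpace.rankOne ℂ (j₁ f) (j₁ f) := by
  rw [iotaHom_eq_weightedOp_zero, weightedOp_rankOne, toWeighted_zero]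

theorem isSelfAdjoint_rankOne (f : SSpace) : IsSelfAdjoint (rankOne f) := by
  refine iotaHom_injective ?_
  rw [map_star, iotaHom_rankOne, ContinuousLinearMap.star_eq_adjoint,
    InnerProductSpace.adjoint_rankOne]

theorem mul_rankOne_of_apply_eq_smul {x : SmoothOp} {f : SSpace} {c : ℂ}
    (h : iotaHom x (j₁ f) = c • j₁ f) : x * rankOne f = c • rankOne f := by
  refine iotaHom_injective ?_
  ext1 ξ
  simp only [map_mul, map_smul, iotaHom_rankOne, mul_apply_eq_comp,
    smul_apply, InnerProductSpace.rankOne_apply, h, smul_comm c]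

end RankOne

section Estimates

theorem sNorm_sq_le (q : ℕ) (f : SSpace) : sNorm q f ^ 2 ≤ sNorm 0 f * sNorm (2 * q) f := by
  have hinner : ⟪toWeighted q f, toWeighted q f⟫_ℂ =
      ⟪toWeighted 0 f, toWeighted (2 * q) f⟫_ℂ := by
    rw [lp.inner_eq_tsum, lp.inner_eq_tsum]
    refine tsum_congr fun j => ?_
    change ⟪weighted q f j, weighted q f j⟫_ℂ = ⟪weighted (0 : ℕ) f j, weighted (2 * q : ℕ) f j⟫_ℂ
    simp only [weighted, RCLike.inner_apply, map_mul, Complex.conj_ofReal, zpow_natCast, pow_mul',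
      pow_zero]
    push_cast
    ring
  calc sNorm q f ^ 2 = ‖⟪toWeighted q f, toWeighted q f⟫_ℂ‖ := by
        rw [inner_self_eq_norm_sq_to_K, norm_toWeighted]
        simp
    _ ≤ sNorm 0 f * sNorm (2 * q) f := by
        rw [hinner, ← norm_toWeighted, ← norm_toWeighted]
        exact norm_inner_le_norm _ _

theorem norm_j₁_sq_le (f : SSpace) : ‖j₁ f‖ ^ 2 ≤ wNorm (-1) f * sNorm 1 f := by
  have hpair : pairing f f = ⟪j₁ f, j₁ f⟫_ℂ := by
    rw [lp.inner_eq_tsum]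
    exact tsum_congr fun i => rfl
  calc ‖j₁ f‖ ^ 2 = ‖pairing f f‖ := by
        rw [hpair, inner_self_eq_norm_sq_to_K]
        simp
    _ ≤ wNorm (-1) f * sNorm 1 f :=
        norm_pairing_le (t := (1 : ℕ)) ((f.2 0).mono (by norm_num)) (f.2 1)

/- The three factors `|f|_0 = 1`, `1 ≤ |f|'_1 |f|_1` and `|f|_r ^ 4 ≤ |f|_{4r}` trade two powers of
`|f|_q` for one power of a higher norm and the summable quantity `(|f|'_1)²`. -/
theorem sNorm_sq_le_mul_wNorm_neg_one_sq (q : ℕ) {f : SSpace} (hf : ‖j₁ f‖ = 1) :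
    sNorm q f ^ 2 ≤ sNorm (4 * q + 4) f * wNorm (-1) f ^ 2 := by
  have hsq : ∀ r, sNorm r f ^ 2 ≤ sNorm (2 * r) f := fun r => by
    simpa [← norm_toWeighted 0, toWeighted_zero, hf] using sNorm_sq_le r f
  have hmono : ∀ r, r ≤ q + 1 → sNorm r f ≤ sNorm (q + 1) f := fun r hr =>
    wNorm_mono (mod_cast hr) (f.2 (q + 1))
  have hdual : 1 ≤ wNorm (-1) f * sNorm 1 f := by simpa [hf] using norm_j₁_sq_le f
  have hnonneg : ∀ r, 0 ≤ sNorm r f := fun r => apply_nonneg _ _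
  have hfour : (sNorm (q + 1) f ^ 2) ^ 2 ≤ sNorm (4 * q + 4) f :=
    calc (sNorm (q + 1) f ^ 2) ^ 2 ≤ sNorm (2 * (q + 1)) f ^ 2 :=
          pow_le_pow_left₀ (sq_nonneg _) (hsq _) 2
      _ ≤ sNorm (2 * (2 * (q + 1))) f := hsq _
      _ = sNorm (4 * q + 4) f := by ring_nf
  calc sNorm q f ^ 2 ≤ sNorm (q + 1) f ^ 2 * (wNorm (-1) f * sNorm 1 f) ^ 2 :=
        (pow_le_pow_left₀ (hnonneg q) (hmono q (by omega)) 2).trans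
          (le_mul_of_one_le_right (sq_nonneg _) (one_le_pow₀ hdual))
    _ ≤ sNorm (q + 1) f ^ 2 * (wNorm (-1) f * sNorm (q + 1) f) ^ 2 := by
        have := hnonneg 1
        have := wNorm_nonneg (-1) f
        gcongr
        exact hmono 1 (by omega)
    _ = (sNorm (q + 1) f ^ 2) ^ 2 * wNorm (-1) f ^ 2 := by ring
    _ ≤ sNorm (4 * q + 4) f * wNorm (-1) f ^ 2 := by gcongr

theorem sum_norm_apply_sq_le_one {α : Type*} {f : α → L2} (hf : Orthonormal ℂ f) (s : Finset α)
    (i : ℕ) : ∑ a ∈ s, ‖f a i‖ ^ 2 ≤ 1 := by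
  have h := hf.sum_inner_products_le (s := s) (lp.single 2 i (1 : ℂ) : L2)
  simpa [lp.inner_single_right, lp.norm_single] using h

theorem wNorm_sq_eq_tsum (t : ℤ) (ξ : ℕ → ℂ) :
    wNorm t ξ ^ 2 = ∑' i : ℕ, ‖ξ i‖ ^ 2 * ((i : ℝ) + 1) ^ (2 * t) :=
  Real.sq_sqrt (tsum_nonneg fun i => by positivity)

theorem sum_wNorm_neg_one_sq_le {α : Type*} {f : α → SSpace} (hf : Orthonormal ℂ fun a => j₁ (f a))
    (s : Finset α) : ∑ a ∈ s, wNorm (-1) (f a) ^ 2 ≤ ∑' i : ℕ, 1 / ((i : ℝ) + 1) ^ 2 := by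
  have hsum : ∀ a ∈ s, Summable fun i : ℕ => ‖f a i‖ ^ 2 * ((i : ℝ) + 1) ^ (2 * (-1) : ℤ) :=
    fun a _ => ((f a).2 0).mono (by norm_num)
  simp only [wNorm_sq_eq_tsum]
  rw [← Summable.tsum_finsetSum hsum]
  refine Summable.tsum_le_tsum (fun i => ?_) (summable_sum hsum) summable_inv_succ_sq
  rw [← Finset.sum_mul, one_div, mul_neg_one, zpow_neg]
  exact mul_le_of_le_one_left (by positivity) (sum_norm_apply_sq_le_one hf s i)

end Estimates

section BlockProj

variable {f : ℕ → SSpace} {N : ℕ → Finset ℕ}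

theorem isSelfAdjoint_blockProj (k : ℕ) : IsSelfAdjoint (blockProj f N k) :=
  isSelfAdjoint_sum _ fun j _ => isSelfAdjoint_rankOne (f j)

theorem iotaHom_blockProj_apply (k : ℕ) (ξ : L2) :
    iotaHom (blockProj f N k) ξ = ∑ j ∈ N k, ⟪j₁ (f j), ξ⟫_ℂ • j₁ (f j) := by
  simp only [blockProj, map_sum, iotaHom_rankOne, sum_apply, InnerProductSpace.rankOne_apply]

theorem iotaHom_blockProj_apply_j₁ (hf : IsOrthonormalSeq f) (k j : ℕ) :
    iotaHom (blockProj f N k) (j₁ (f j)) = (if j ∈ N k then (1 : ℂ) else 0) • j₁ (f j) := by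
  simp only [iotaHom_blockProj_apply, orthonormal_iff_ite.1 hf, ite_smul, one_smul, zero_smul,
    Finset.sum_ite_eq']

theorem blockProj_mul_rankOne (hf : IsOrthonormalSeq f) (k j : ℕ) :
    blockProj f N k * rankOne (f j) = (if j ∈ N k then (1 : ℂ) else 0) • rankOne (f j) :=
  mul_rankOne_of_apply_eq_smul (iotaHom_blockProj_apply_j₁ hf k j)

theorem blockProj_mul_self (hf : IsOrthonormalSeq f) (k : ℕ) :
    blockProj f N k * blockProj f N k = blockProj f N k := by
  conv_lhs => enter [2]; rw [blockProj]
  rw [Finset.mul_sum]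
  exact Finset.sum_congr rfl fun j hj => by rw [blockProj_mul_rankOne hf, if_pos hj, one_smul]

theorem blockProj_mul_of_ne (hf : IsOrthonormalSeq f)
    (hd : Pairwise fun k l => Disjoint (N k) (N l)) {k l : ℕ} (hkl : k ≠ l) :
    blockProj f N k * blockProj f N l = 0 := by
  conv_lhs => enter [2]; rw [blockProj]
  rw [Finset.mul_sum]
  exact Finset.sum_eq_zero fun j hj => by
    rw [blockProj_mul_rankOne hf, if_neg (Finset.disjoint_right.1 (hd hkl) hj), zero_smul]

theorem isStarProjection_blockProj (hf : IsOrthonormalSeq f) (k : ℕ) :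
    IsStarProjection (blockProj f N k) :=
  ⟨blockProj_mul_self hf k, isSelfAdjoint_blockProj k⟩

theorem blockProj_ne_zero (hf : IsOrthonormalSeq f) (hN : ∀ k, (N k).Nonempty) (k : ℕ) :
    blockProj f N k ≠ 0 := by
  obtain ⟨j, hj⟩ := hN k
  intro h
  have happly := iotaHom_blockProj_apply_j₁ hf k j (N := N)
  rw [h, map_zero, if_pos hj, one_smul] at happly
  exact hf.ne_zero j happly.symm

theorem apply_eq_smul_of_mul_blockProj (hf : IsOrthonormalSeq f) {x : SmoothOp} {k j : ℕ} {c : ℂ}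
    (hj : j ∈ N k) (h : x * blockProj f N k = c • blockProj f N k) :
    x (j₂ (j₁ (f j))) = c • f j := by
  have happly := congrArg (fun T : L2 →L[ℂ] L2 => T (j₁ (f j))) (congrArg iotaHom h)
  simp only [map_mul, map_smul, mul_apply_eq_comp, smul_apply,
    iotaHom_blockProj_apply_j₁ hf, if_pos hj, one_smul] at happly
  exact j₁_injective (happly.trans (map_smul j₁ c (f j)).symm)

theorem norm_weightedOp_blockProj_le (hf : IsOrthonormalSeq f) (hN : ∀ k, (N k).Nonempty)
    (q k : ℕ) : ‖weightedOp q (blockProj f N k)‖ ≤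
      (maxMatrix f hf N hN).entry k (4 * q + 4) * ∑ j ∈ N k, wNorm (-1) (f j) ^ 2 := by
  rw [blockProj, map_sum, Finset.mul_sum]
  refine (norm_sum_le _ _).trans (Finset.sum_le_sum fun j hj => ?_)
  rw [norm_weightedOp_rankOne]
  exact (sNorm_sq_le_mul_wNorm_neg_one_sq q (hf.1 j)).trans <|
    mul_le_mul_of_nonneg_right (Finset.le_sup' (fun j => sNorm (4 * q + 4) (f j)) hj) (sq_nonneg _)

theorem norm_mul_entry_le (hf : IsOrthonormalSeq f) (hN : ∀ k, (N k).Nonempty) {x : SmoothOp}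
    {k : ℕ} {c : ℂ} (h : x * blockProj f N k = c • blockProj f N k) (q : ℕ) :
    ‖c‖ * (maxMatrix f hf N hN).entry k q ≤ ‖weightedOp q x‖ := by
  obtain ⟨j, hj, hmax⟩ := Finset.exists_mem_eq_sup' (hN k) fun j => sNorm q (f j)
  have hneg : SqSummable (-q) (j₂ (j₁ (f j))) := (sqSummable_L2 (j₁ (f j))).mono (by simp)
  have hle : wNorm (-q) (j₂ (j₁ (f j))) ≤ 1 :=
    (wNorm_mono (by simp) (sqSummable_L2 (j₁ (f j)))).trans_eq ((wNorm_L2 _).trans (hf.1 j))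
  calc ‖c‖ * (maxMatrix f hf N hN).entry k q = ‖c‖ * sNorm q (f j) := congrArg (‖c‖ * ·) hmax
    _ = sNorm q (x (j₂ (j₁ (f j)))) := by
        rw [apply_eq_smul_of_mul_blockProj hf hj h, map_smul_eq_mul]
    _ ≤ ‖weightedOp q x‖ * wNorm (-q) (j₂ (j₁ (f j))) := sNorm_apply_le q x _ hneg
    _ ≤ ‖weightedOp q x‖ := mul_le_of_le_one_right (norm_nonneg _) hle

end BlockProj

instance : SeparatelyContinuousMul SmoothOp where
  continuous_const_mul {x} :=
    (ContinuousLinearMap.postcomp SDual (x.comp (j₂.comp j₁))).continuous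
  continuous_mul_const {y} :=
    (ContinuousLinearMap.precomp SSpace ((j₂.comp j₁).comp y)).continuous

theorem norm_mul_entry_le_kotheSeminorm {A : KotheMatrix} (c : KotheSpace A) (k q : ℕ) :
    ‖c k‖ * A.entry k q ≤ kotheSeminorm A q c :=
  le_ciSup (c.2 q) k

section Synthesis

variable {f : ℕ → SSpace} {N : ℕ → Finset ℕ} (hf : IsOrthonormalSeq f) (hN : ∀ k, (N k).Nonempty)
  (hd : Pairwise fun k l => Disjoint (N k) (N l))

include hf hd in
theorem sum_sum_wNorm_neg_one_sq_le (s : Finset ℕ) :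
    ∑ k ∈ s, ∑ j ∈ N k, wNorm (-1) (f j) ^ 2 ≤ ∑' i : ℕ, 1 / ((i : ℝ) + 1) ^ 2 := by
  rw [← Finset.sum_biUnion fun k _ l _ hkl => hd hkl]
  exact sum_wNorm_neg_one_sq_le hf _

include hd in
theorem sum_norm_weightedOp_smul_blockProj_le (c : KotheSpace (maxMatrix f hf N hN)) (q : ℕ)
    (s : Finset ℕ) : ∑ k ∈ s, ‖weightedOp q (c k • blockProj f N k)‖ ≤
      (∑' i : ℕ, 1 / ((i : ℝ) + 1) ^ 2) * kotheSeminorm _ (4 * q + 4) c := by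
  calc ∑ k ∈ s, ‖weightedOp q (c k • blockProj f N k)‖
      ≤ ∑ k ∈ s, (∑ j ∈ N k, wNorm (-1) (f j) ^ 2) * kotheSeminorm _ (4 * q + 4) c := by
        refine Finset.sum_le_sum fun k _ => ?_
        rw [map_smul, norm_smul, mul_comm (∑ j ∈ N k, _)]
        refine (mul_le_mul_of_nonneg_left (norm_weightedOp_blockProj_le hf hN q k)
          (norm_nonneg _)).trans ?_
        rw [← mul_assoc]
        exact mul_le_mul_of_nonneg_right (norm_mul_entry_le_kotheSeminorm c k _)
          (Finset.sum_nonneg fun j _ => sq_nonneg _)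
    _ ≤ (∑' i : ℕ, 1 / ((i : ℝ) + 1) ^ 2) * kotheSeminorm _ (4 * q + 4) c := by
        rw [← Finset.sum_mul]
        exact mul_le_mul_of_nonneg_right (sum_sum_wNorm_neg_one_sq_le hf hd s) (apply_nonneg _ _)

include hd in
theorem summable_norm_weightedOp_smul_blockProj (c : KotheSpace (maxMatrix f hf N hN)) (q : ℕ) :
    Summable fun k => ‖weightedOp q (c k • blockProj f N k)‖ :=
  summable_of_sum_le (fun _ => norm_nonneg _)
    (sum_norm_weightedOp_smul_blockProj_le hf hN hd c q)

include hd in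
theorem summable_smul_blockProj (c : KotheSpace (maxMatrix f hf N hN)) :
    Summable fun k => c k • blockProj f N k := by
  refine exists_tendsto_of_weightedOp
    (T := fun q => ∑' k, weightedOp q (c k • blockProj f N k)) fun q => ?_
  simp only [map_sum]
  exact (summable_norm_weightedOp_smul_blockProj hf hN hd c q).of_norm.hasSum

/-- The linear map underlying `synthesis`. -/
def synthesisLin : KotheSpace (maxMatrix f hf N hN) →ₗ[ℂ] SmoothOp where
  toFun c := ∑' k, c k • blockProj f N k
  map_add' c d := by
    rw [← (summable_smul_blockProj hf hN hd c).tsum_add (summable_smul_blockProj hf hN hd d)]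
    exact tsum_congr fun k => add_smul _ _ _
  map_smul' r c := by
    rw [RingHom.id_apply, ← tsum_const_smul'' r]
    exact tsum_congr fun k => mul_smul _ _ _

theorem norm_weightedOp_synthesisLin_le (c : KotheSpace (maxMatrix f hf N hN)) (q : ℕ) :
    ‖weightedOp q (synthesisLin hf hN hd c)‖ ≤
      (∑' i : ℕ, 1 / ((i : ℝ) + 1) ^ 2) * kotheSeminorm _ (4 * q + 4) c := by
  have hsum := summable_norm_weightedOp_smul_blockProj hf hN hd c q
  rw [synthesisLin, LinearMap.coe_mk, AddHom.coe_mk,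
    (weightedOp q).map_tsum (summable_smul_blockProj hf hN hd c)]
  exact (norm_tsum_le_tsum_norm hsum).trans
    (hsum.tsum_le_of_sum_le (sum_norm_weightedOp_smul_blockProj_le hf hN hd c q))

/-- The map `c ↦ ∑ c_k P_k` from `λ^∞(max_{j ∈ N_k} |f_j|_q)` to `L(s', s)`, where
`P_k = ∑_{j ∈ N_k} ⟨·, f_j⟩ f_j`. -/
def synthesis : KotheSpace (maxMatrix f hf N hN) →L[ℂ] SmoothOp where
  toLinearMap := synthesisLin hf hN hd
  cont := continuous_smoothOp_iff.2 fun q =>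
    WithSeminorms.continuous_normedSpace_rng (L2 →L[ℂ] L2) (withSeminorms_kothe _)
      ((weightedOp q).toLinearMap.comp (synthesisLin hf hN hd))
      ⟨{4 * q + 4}, ⟨∑' i : ℕ, 1 / ((i : ℝ) + 1) ^ 2, tsum_nonneg fun i => by positivity⟩,
        fun c => by
          rw [Finset.sup_singleton]
          exact norm_weightedOp_synthesisLin_le hf hN hd c q⟩

theorem hasSum_synthesis (c : KotheSpace (maxMatrix f hf N hN)) :
    HasSum (fun k => c k • blockProj f N k) (synthesis hf hN hd c) :=
  (summable_smul_blockProj hf hN hd c).hasSum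

theorem synthesis_kotheUnit (k : ℕ) :
    synthesis hf hN hd (kotheUnit _ k) = blockProj f N k := by
  have happly : ∀ l, kotheUnit (maxMatrix f hf N hN) k l = (Pi.single k 1 : ℕ → ℂ) l := fun _ => rfl
  refine (tsum_eq_single k fun l hl => ?_).trans ?_
  · rw [happly, Pi.single_eq_of_ne hl, zero_smul]
  · rw [happly, Pi.single_eq_same, one_smul]

include hf hd in
theorem mul_blockProj_of_tendsto {c : ℕ → ℂ} {x : SmoothOp}
    (h : Tendsto (fun n => ∑ k ∈ Finset.range n, c k • blockProj f N k) atTop (𝓝 x)) (k : ℕ) :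
    x * blockProj f N k = c k • blockProj f N k := by
  refine tendsto_nhds_unique (((continuous_mul_const (blockProj f N k)).tendsto x).comp h)
    (tendsto_const_nhds.congr' ?_)
  filter_upwards [eventually_gt_atTop k] with n hn
  rw [Function.comp_apply, Finset.sum_mul, Finset.sum_eq_single_of_mem k (Finset.mem_range.2 hn),
    smul_mul_assoc, blockProj_mul_self hf]
  intro l _ hlk
  rw [smul_mul_assoc, blockProj_mul_of_ne hf hd hlk, smul_zero]

theorem synthesis_mul_blockProj (c : KotheSpace (maxMatrix f hf N hN)) (k : ℕ) :
    synthesis hf hN hd c * blockProj f N k = c k • blockProj f N k :=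
  mul_blockProj_of_tendsto hf hd (hasSum_synthesis hf hN hd c).tendsto_sum_nat k

theorem synthesis_mul (c d : KotheSpace (maxMatrix f hf N hN)) :
    synthesis hf hN hd (c * d) = synthesis hf hN hd c * synthesis hf hN hd d := by
  have hsum := (hasSum_synthesis hf hN hd d).map
    (AddMonoidHom.mulLeft (synthesis hf hN hd c)) (continuous_const_mul _)
  refine (hasSum_synthesis hf hN hd (c * d)).unique (hsum.congr_fun fun k => ?_)
  change (c k * d k) • _ = synthesis hf hN hd c * (d k • blockProj f N k)
  rw [mul_smul_comm, synthesis_mul_blockProj, smul_smul, mul_comm]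

theorem synthesis_star (c : KotheSpace (maxMatrix f hf N hN)) :
    synthesis hf hN hd (star c) = star (synthesis hf hN hd c) := by
  have hiota := fun d => (hasSum_synthesis hf hN hd d).map iotaHom continuous_iotaHom
  refine iotaHom_injective ((hiota (star c)).unique ?_)
  rw [map_star]
  refine (hiota c).star.congr_fun fun k => ?_
  change iotaHom (star (c k) • _) = star (iotaHom (c k • _))
  rw [← map_star, star_smul, (isSelfAdjoint_blockProj k).star_eq]

end Synthesis

section Coefficients

variable {f : ℕ → SSpace} {N : ℕ → Finset ℕ}

/-- The `k`-th coefficient of an operator with respect to the blocks `N`: the mean of the diagonal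
entries `⟨x f_j, f_j⟩` with `j ∈ N_k`. -/
def blockCoeff (f : ℕ → SSpace) (N : ℕ → Finset ℕ) (k : ℕ) : SmoothOp →L[ℂ] ℂ :=
  ((N k).card : ℂ)⁻¹ • ∑ j ∈ N k,
    (innerSL ℂ (j₁ (f j))).comp ((ContinuousLinearMap.apply ℂ L2 (j₁ (f j))).comp (weightedOp 0))

theorem blockCoeff_eq_of_mul_blockProj (hf : IsOrthonormalSeq f) (hN : ∀ k, (N k).Nonempty)
    {x : SmoothOp} {k : ℕ} {c : ℂ} (h : x * blockProj f N k = c • blockProj f N k) :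
    blockCoeff f N k x = c := by
  have hentry : ∀ j ∈ N k, ⟪j₁ (f j), weightedOp 0 x (j₁ (f j))⟫_ℂ = c := by
    intro j hj
    rw [← iotaHom_eq_weightedOp_zero, iotaHom_apply, apply_eq_smul_of_mul_blockProj hf hj h,
      map_smul, inner_smul_right, inner_self_eq_norm_sq_to_K, hf.1]
    simp
  have hcard : ((N k).card : ℂ) ≠ 0 := Nat.cast_ne_zero.2 (hN k).card_pos.ne'
  simp only [blockCoeff, smul_apply, sum_apply, ContinuousLinearMap.comp_apply,
    ContinuousLinearMap.apply_apply, innerSL_apply_apply, smul_eq_mul]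
  rw [Finset.sum_congr rfl hentry, Finset.sum_const, nsmul_eq_mul, inv_mul_cancel_left₀ hcard]

/-- The operators that act on the range of each block projection as a scalar. -/
def blockScalars (f : ℕ → SSpace) (N : ℕ → Finset ℕ) : Submodule ℂ SmoothOp where
  carrier := {x | ∀ k, x * blockProj f N k = blockCoeff f N k x • blockProj f N k}
  zero_mem' k := by rw [zero_mul, map_zero, zero_smul]
  add_mem' hx hy k := by rw [add_mul, hx k, hy k, map_add, add_smul]
  smul_mem' c x hx k := by rw [smul_mul_assoc, hx k, map_smul, smul_assoc]

theorem mem_blockScalars_of_forall_exists (hf : IsOrthonormalSeq f) (hN : ∀ k, (N k).Nonempty)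
    {x : SmoothOp} (h : ∀ k, ∃ c : ℂ, x * blockProj f N k = c • blockProj f N k) :
    x ∈ blockScalars f N := by
  intro k
  obtain ⟨c, hc⟩ := h k
  rw [blockCoeff_eq_of_mul_blockProj hf hN hc, hc]

theorem isClosed_blockScalars : IsClosed (blockScalars f N : Set SmoothOp) := by
  have hinter : (blockScalars f N : Set SmoothOp) =
      ⋂ k, {x | x * blockProj f N k = blockCoeff f N k x • blockProj f N k} :=
    Set.ext fun x => by rw [Set.mem_iInter]; rfl
  rw [hinter]
  exact isClosed_iInter fun k => isClosed_eq (continuous_mul_const _)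
    ((blockCoeff f N k).continuous.smul continuous_const)

variable (hf : IsOrthonormalSeq f) (hN : ∀ k, (N k).Nonempty)

/-- The linear map underlying `coeffMap`. -/
def coeffLin : blockScalars f N →ₗ[ℂ] KotheSpace (maxMatrix f hf N hN) where
  toFun x := ⟨fun k => blockCoeff f N k x, fun q => ⟨‖weightedOp q x‖, by
    rintro _ ⟨k, rfl⟩
    exact norm_mul_entry_le hf hN (x.2 k) q⟩⟩
  map_add' x y := Subtype.ext (funext fun k => map_add (blockCoeff f N k) (x : SmoothOp) y)
  map_smul' c x := Subtype.ext (funext fun k => map_smul (blockCoeff f N k) c (x : SmoothOp))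

/-- The map from an operator to its sequence of block coefficients. -/
def coeffMap : blockScalars f N →L[ℂ] KotheSpace (maxMatrix f hf N hN) where
  toLinearMap := coeffLin hf hN
  cont := (withSeminorms_kothe _).continuous_of_continuous_comp _ fun q =>
    Seminorm.continuous_of_le
      (q := (normSeminorm ℂ (L2 →L[ℂ] L2)).comp
        ((weightedOp q).toLinearMap.comp (blockScalars f N).subtype))
      ((weightedOp q).continuous.comp continuous_subtype_val).norm
      fun x => ciSup_le fun k => norm_mul_entry_le hf hN (x.2 k) q

variable (hd : Pairwise fun k l => Disjoint (N k) (N l))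

theorem synthesis_mem_blockScalars (c : KotheSpace (maxMatrix f hf N hN)) :
    synthesis hf hN hd c ∈ blockScalars f N :=
  mem_blockScalars_of_forall_exists hf hN fun k => ⟨c k, synthesis_mul_blockProj hf hN hd c k⟩

theorem coeffMap_synthesis (c : KotheSpace (maxMatrix f hf N hN)) :
    coeffMap hf hN ⟨synthesis hf hN hd c, synthesis_mem_blockScalars hf hN hd c⟩ = c :=
  Subtype.ext <| funext fun k =>
    blockCoeff_eq_of_mul_blockProj hf hN (synthesis_mul_blockProj hf hN hd c k)

end Coefficients

section BlockAlgebra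

variable {f : ℕ → SSpace} {N : ℕ → Finset ℕ} (hf : IsOrthonormalSeq f) (hN : ∀ k, (N k).Nonempty)
  (hd : Pairwise fun k l => Disjoint (N k) (N l))

/-- The `*`-algebra of the operators `∑ c_k P_k` with `c ∈ λ^∞(max_{j ∈ N_k} |f_j|_q)`, where
`P_k = ∑_{j ∈ N_k} ⟨·, f_j⟩ f_j`. -/
def blockAlgebra : NonUnitalStarSubalgebra ℂ SmoothOp where
  carrier := Set.range (synthesis hf hN hd)
  zero_mem' := ⟨0, map_zero _⟩
  add_mem' := by
    rintro _ _ ⟨c, rfl⟩ ⟨d, rfl⟩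
    exact ⟨c + d, map_add _ c d⟩
  smul_mem' := by
    rintro r _ ⟨c, rfl⟩
    exact ⟨r • c, map_smul _ r c⟩
  mul_mem' := by
    rintro _ _ ⟨c, rfl⟩ ⟨d, rfl⟩
    exact ⟨c * d, synthesis_mul hf hN hd c d⟩
  star_mem' := by
    rintro _ ⟨c, rfl⟩
    exact ⟨star c, synthesis_star hf hN hd c⟩

theorem blockProj_mem_blockAlgebra (k : ℕ) : blockProj f N k ∈ blockAlgebra hf hN hd :=
  ⟨kotheUnit _ k, synthesis_kotheUnit hf hN hd k⟩

theorem blockAlgebra_subset_blockScalars :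
    (blockAlgebra hf hN hd : Set SmoothOp) ⊆ blockScalars f N := by
  rintro _ ⟨c, rfl⟩
  exact synthesis_mem_blockScalars hf hN hd c

theorem mem_blockAlgebra_iff {x : SmoothOp} (hx : x ∈ blockScalars f N) :
    x ∈ blockAlgebra hf hN hd ↔ synthesis hf hN hd (coeffMap hf hN ⟨x, hx⟩) = x := by
  refine ⟨?_, fun h => ⟨_, h⟩⟩
  rintro ⟨c, rfl⟩
  rw [coeffMap_synthesis]

theorem isClosed_blockAlgebra : IsClosed (blockAlgebra hf hN hd : Set SmoothOp) := by
  have himage : (blockAlgebra hf hN hd : Set SmoothOp) =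
      (↑) '' {x : blockScalars f N | synthesis hf hN hd (coeffMap hf hN x) = x} := by
    ext x
    refine ⟨fun h => ?_, ?_⟩
    · have hx := blockAlgebra_subset_blockScalars hf hN hd h
      exact ⟨⟨x, hx⟩, (mem_blockAlgebra_iff hf hN hd hx).1 h, rfl⟩
    · rintro ⟨y, hy, rfl⟩
      exact (mem_blockAlgebra_iff hf hN hd y.2).2 hy
  rw [himage]
  exact isClosed_blockScalars.isClosedEmbedding_subtypeVal.isClosedMap _ <|
    isClosed_eq ((synthesis hf hN hd).continuous.comp (coeffMap hf hN).continuous)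
      continuous_subtype_val

theorem blockAlgebra_comm : ∀ x ∈ blockAlgebra hf hN hd, ∀ y ∈ blockAlgebra hf hN hd,
    x * y = y * x := by
  rintro _ ⟨c, rfl⟩ _ ⟨d, rfl⟩
  rw [← synthesis_mul, ← synthesis_mul]
  exact congrArg _ (Subtype.ext (mul_comm c.1 d.1))

include hf hN hd in
theorem linearIndependent_blockProj : LinearIndependent ℂ (blockProj f N) := by
  rw [linearIndependent_iff']
  intro s g hg k hk
  have hmul := congrArg (· * blockProj f N k) hg
  simp only [Finset.sum_mul, zero_mul, smul_mul_assoc] at hmul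
  rw [Finset.sum_eq_single_of_mem k hk, blockProj_mul_self hf] at hmul
  · exact (smul_eq_zero.1 hmul).resolve_right (blockProj_ne_zero hf hN k)
  · intro l _ hlk
    rw [blockProj_mul_of_ne hf hd hlk, smul_zero]

theorem isInfDimClosedComm_blockAlgebra : IsInfDimClosedComm (blockAlgebra hf hN hd) where
  infinite_dimensional := by
    intro hfin
    have : FiniteDimensional ℂ (blockAlgebra hf hN hd).toNonUnitalSubalgebra.toSubmodule := hfin
    let P : ℕ → (blockAlgebra hf hN hd).toNonUnitalSubalgebra.toSubmodule :=
      fun k => ⟨blockProj f N k, blockProj_mem_blockAlgebra hf hN hd k⟩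
    have hP : LinearIndependent ℂ P :=
      LinearIndependent.of_comp (Submodule.subtype _) (linearIndependent_blockProj hf hN hd)
    exact not_finite_iff_infinite.2 inferInstance hP.finite
  isClosed := isClosed_blockAlgebra hf hN hd
  comm := blockAlgebra_comm hf hN hd

theorem eq_zero_or_one_of_mul_eq_smul {𝕜 A : Type*} [Field 𝕜] [NonUnitalRing A] [Module 𝕜 A]
    [SMulCommClass 𝕜 A A] {x p : A} {c : 𝕜} (hx : IsIdempotentElem x) (hp : p ≠ 0)
    (h : x * p = c • p) : c = 0 ∨ c = 1 := by
  refine IsIdempotentElem.iff_eq_zero_or_one.1 (smul_left_injective 𝕜 hp ?_)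
  calc (c * c) • p = x * (x * p) := by rw [h, mul_smul_comm, h, smul_smul]
    _ = c • p := by rw [← mul_assoc, hx.eq, h]

theorem isMinimalProjection_blockProj (k : ℕ) :
    IsMinimalProjection (blockAlgebra hf hN hd) (blockProj f N k) where
  mem := blockProj_mem_blockAlgebra hf hN hd k
  isStarProjection := isStarProjection_blockProj hf k
  ne_zero := blockProj_ne_zero hf hN k
  minimal Q hQ hproj hle _ := by
    have hscalar := blockAlgebra_subset_blockScalars hf hN hd hQ k
    rw [hle] at hscalar
    refine (eq_zero_or_one_of_mul_eq_smul hproj.isIdempotentElem (blockProj_ne_zero hf hN k)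
      (hle.trans hscalar)).imp (fun h => ?_) fun h => ?_
    · rw [hscalar, h, zero_smul]
    · rw [hscalar, h, one_smul]

theorem exists_eq_blockProj_of_isMinimalProjection {Q : SmoothOp}
    (hQ : IsMinimalProjection (blockAlgebra hf hN hd) Q) : ∃ k, blockProj f N k = Q := by
  obtain ⟨c, rfl⟩ := hQ.mem
  obtain ⟨k, hk⟩ : ∃ k, c k ≠ 0 := by
    by_contra! h
    exact hQ.ne_zero ((congrArg _ (Subtype.ext (funext h))).trans (map_zero (synthesis hf hN hd)))
  have hmul := synthesis_mul_blockProj hf hN hd c k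
  have hmem := blockProj_mem_blockAlgebra hf hN hd k
  rw [(eq_zero_or_one_of_mul_eq_smul hQ.isStarProjection.isIdempotentElem
    (blockProj_ne_zero hf hN k) hmul).resolve_left hk, one_smul] at hmul
  exact ⟨k, (hQ.minimal _ hmem (isStarProjection_blockProj hf k)
    ((blockAlgebra_comm hf hN hd _ hmem _ hQ.mem).trans hmul) hmul).resolve_left
      (blockProj_ne_zero hf hN k)⟩

theorem isCanonicalBasis_blockAlgebra :
    IsCanonicalBasis (blockAlgebra hf hN hd) (blockProj f N) where
  injective := (linearIndependent_blockProj hf hN hd).injective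
  range_eq := Set.Subset.antisymm
    (Set.range_subset_iff.2 (isMinimalProjection_blockProj hf hN hd))
    fun _ hQ => exists_eq_blockProj_of_isMinimalProjection hf hN hd hQ

theorem isSchauderBasis_blockAlgebra :
    IsSchauderBasis (blockAlgebra hf hN hd) (blockProj f N) where
  mem := blockProj_mem_blockAlgebra hf hN hd
  expansion := by
    rintro _ ⟨c, rfl⟩
    refine ⟨c, (hasSum_synthesis hf hN hd c).tendsto_sum_nat, fun d hd' => funext fun k => ?_⟩
    exact smul_left_injective ℂ (blockProj_ne_zero hf hN k) <|
      (mul_blockProj_of_tendsto hf hd hd' k).symm.trans (synthesis_mul_blockProj hf hN hd c k)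

/-- `synthesis` as an isomorphism of `λ^∞(max_{j ∈ N_k} |f_j|_q)` onto `blockAlgebra`. -/
def synthesisEquiv : KotheSpace (maxMatrix f hf N hN) ≃⋆ₐ[ℂ] blockAlgebra hf hN hd where
  toFun c := ⟨synthesis hf hN hd c, c, rfl⟩
  invFun x := coeffMap hf hN ⟨x, blockAlgebra_subset_blockScalars hf hN hd x.2⟩
  left_inv c := coeffMap_synthesis hf hN hd c
  right_inv x := Subtype.ext ((mem_blockAlgebra_iff hf hN hd _).1 x.2)
  map_mul' c d := Subtype.ext (synthesis_mul hf hN hd c d)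
  map_add' c d := Subtype.ext (map_add (synthesis hf hN hd) c d)
  map_star' c := Subtype.ext (synthesis_star hf hN hd c)
  map_smul' r c := Subtype.ext (map_smul (synthesis hf hN hd) r c)

theorem isHomeomorph_synthesisEquiv_symm : IsHomeomorph (synthesisEquiv hf hN hd).symm :=
  (Homeomorph.mk (synthesisEquiv hf hN hd).symm.toEquiv
    ((coeffMap hf hN).continuous.comp
      (continuous_inclusion (blockAlgebra_subset_blockScalars hf hN hd)))
    ((synthesis hf hN hd).continuous.subtype_mk _)).isHomeomorph

theorem isoVia_blockAlgebra :
    IsoVia (blockAlgebra hf hN hd) (blockProj f N) (maxMatrix f hf N hN) :=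
  ⟨(synthesisEquiv hf hN hd).symm, isHomeomorph_synthesisEquiv_symm hf hN hd, fun k =>
    ⟨blockProj_mem_blockAlgebra hf hN hd k, (synthesisEquiv hf hN hd).symm_apply_eq.2 <|
      Subtype.ext (synthesis_kotheUnit hf hN hd k).symm⟩⟩

end BlockAlgebra

section FixedSpace

variable {H : Type*} [NormedAddCommGroup H] [InnerProductSpace ℂ H] [CompleteSpace H]
  {T : H →L[ℂ] H}

theorem hasEigenvalue_norm_of_nonneg (hc : IsCompactOperator T) (hT : 0 ≤ T) (h0 : T ≠ 0) :
    Module.End.HasEigenvalue (T : Module.End ℂ H) (‖T‖ : ℂ) := by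
  have : Nontrivial (H →L[ℂ] H) := ⟨T, 0, h0⟩
  exact (hc.hasEigenvalue_iff_mem_spectrum (Complex.ofReal_ne_zero.2 (norm_ne_zero_iff.2 h0))).2
    (spectrum.algebraMap_mem ℂ (CStarAlgebra.norm_mem_spectrum_of_nonneg hT))

/-- The orthogonal projection onto the space of fixed points of `T`. -/
def fixedProjection (T : H →L[ℂ] H) : H →L[ℂ] H :=
  (T.eqLocus (1 : H →L[ℂ] H)).starProjection

theorem isStarProjection_fixedProjection : IsStarProjection (fixedProjection T) :=
  isStarProjection_starProjection

theorem fixedProjection_apply_eq_self_iff {v : H} : fixedProjection T v = v ↔ T v = v :=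
  Submodule.starProjection_eq_self_iff

theorem mul_fixedProjection : T * fixedProjection T = fixedProjection T := by
  ext1 v
  exact fixedProjection_apply_eq_self_iff.1 <|
    congrArg (fun S : H →L[ℂ] H => S v) isStarProjection_fixedProjection.isIdempotentElem

theorem fixedProjection_mul (hT : IsSelfAdjoint T) :
    fixedProjection T * T = fixedProjection T := by
  simpa only [star_mul, hT.star_eq, isStarProjection_fixedProjection.isSelfAdjoint.star_eq]
    using congrArg star (mul_fixedProjection (T := T))

theorem fixedProjection_ne_zero (hc : IsCompactOperator T) (hT : 0 ≤ T) (h1 : ‖T‖ = 1) :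
    fixedProjection T ≠ 0 := by
  obtain ⟨v, hv⟩ := (hasEigenvalue_norm_of_nonneg hc hT
    (norm_ne_zero_iff.1 (h1 ▸ one_ne_zero))).exists_hasEigenvector
  have hfix : fixedProjection T v = v := fixedProjection_apply_eq_self_iff.2 <| by
    simpa [h1] using hv.apply_eq_smul
  rintro h
  exact hv.2 (by rw [← hfix, h, zero_apply])

theorem sub_fixedProjection_nonneg (hT : 0 ≤ T) : 0 ≤ T - fixedProjection T := by
  have hQ := isStarProjection_fixedProjection (T := T)
  have hconj : (1 - fixedProjection T) * T * (1 - fixedProjection T) = T - fixedProjection T := by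
    rw [sub_mul, one_mul, fixedProjection_mul (IsSelfAdjoint.of_nonneg hT), sub_mul, mul_sub,
      mul_one, mul_fixedProjection, mul_sub, mul_one, hQ.isIdempotentElem.eq, sub_self, sub_zero]
  exact hconj ▸ hQ.one_sub.isSelfAdjoint.conjugate_nonneg hT

theorem norm_sub_fixedProjection_lt_one (hc : IsCompactOperator T) (hT : 0 ≤ T) (h1 : ‖T‖ ≤ 1) :
    ‖T - fixedProjection T‖ < 1 := by
  have hQ := isStarProjection_fixedProjection (T := T)
  set S := T - fixedProjection T with hS
  rcases eq_or_ne S 0 with h0 | h0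
  · rw [h0, norm_zero]
    exact zero_lt_one
  have hSc : IsCompactOperator S :=
    hc.sub (mul_fixedProjection (T := T) ▸ hc.comp_clm (fixedProjection T))
  obtain ⟨v, hv⟩ :=
    (hasEigenvalue_norm_of_nonneg hSc (sub_fixedProjection_nonneg hT) h0).exists_hasEigenvector
  have hSv : S v = (‖S‖ : ℂ) • v := hv.apply_eq_smul
  have hQS : fixedProjection T * S = 0 := by
    rw [hS, mul_sub, fixedProjection_mul (IsSelfAdjoint.of_nonneg hT), hQ.isIdempotentElem.eq,
      sub_self]
  have hQv : fixedProjection T v = 0 := by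
    have h : fixedProjection T (S v) = 0 := congrArg (fun R : H →L[ℂ] H => R v) hQS
    rw [hSv, map_smul, smul_eq_zero] at h
    exact h.resolve_left (Complex.ofReal_ne_zero.2 (norm_ne_zero_iff.2 h0))
  have hTv : T v = (‖S‖ : ℂ) • v := by rw [← hSv, hS, sub_apply, hQv, sub_zero]
  refine lt_of_le_of_ne ?_ fun hnorm => hv.2 ?_
  · have h := T.le_of_opNorm_le h1 v
    rw [hTv, norm_smul, Complex.norm_real, norm_norm] at h
    exact le_of_mul_le_mul_right h (norm_pos_iff.2 hv.2)
  · rw [hnorm, Complex.ofReal_one, one_smul] at hTv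
    rw [← fixedProjection_apply_eq_self_iff.2 hTv, hQv]

theorem sub_pow_succ_of_mul_eq {R : Type*} [Ring R] {u q : R} (huq : u * q = q)
    (hqu : q * u = q) (hq : IsIdempotentElem q) (n : ℕ) : (u - q) ^ (n + 1) = u ^ (n + 1) - q := by
  induction n with
  | zero => rw [zero_add, pow_one, pow_one]
  | succ n ih =>
    have hpow : u ^ (n + 1) * q = q := by
      clear ih
      induction n with
      | zero => rw [zero_add, pow_one, huq]
      | succ n ih => rw [pow_succ, mul_assoc, huq, ih]
    rw [pow_succ, ih, sub_mul, mul_sub, mul_sub, hpow, hqu, hq.eq, sub_self, sub_zero, ← pow_succ]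

theorem tendsto_pow_succ_fixedProjection (hc : IsCompactOperator T) (hT : 0 ≤ T) (h1 : ‖T‖ ≤ 1) :
    Tendsto (fun n => T ^ (n + 1)) atTop (𝓝 (fixedProjection T)) := by
  rw [← tendsto_sub_nhds_zero_iff]
  refine Tendsto.congr (sub_pow_succ_of_mul_eq mul_fixedProjection
    (fixedProjection_mul (IsSelfAdjoint.of_nonneg hT))
    isStarProjection_fixedProjection.isIdempotentElem) ?_
  exact (tendsto_add_atTop_iff_nat 1).2
    (tendsto_pow_atTop_nhds_zero_of_norm_lt_one (norm_sub_fixedProjection_lt_one hc hT h1))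

end FixedSpace

section Compactness

theorem isCompactOperator_of_summable_norm_apply {ι 𝕜 H F : Type*} [RCLike 𝕜]
    [NormedAddCommGroup H] [InnerProductSpace 𝕜 H] [NormedAddCommGroup F] [NormedSpace 𝕜 F]
    [CompleteSpace F] (b : HilbertBasis ι 𝕜 H) {T : H →L[𝕜] F}
    (hT : Summable fun i => ‖T (b i)‖) : IsCompactOperator T := by
  let S : ι → H →L[𝕜] F := fun i => (innerSL 𝕜 (b i)).smulRight (T (b i))
  have hS : Summable S := by
    refine Summable.of_norm_bounded hT fun i => ?_
    rw [ContinuousLinearMap.norm_smulRight_apply, innerSL_apply_norm, b.orthonormal.1, one_mul]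
  have hsum : HasSum S T := by
    convert hS.hasSum
    ext1 v
    have hTv := (b.hasSum_repr v).mapL T
    refine hTv.unique ((hS.hasSum.mapL (ContinuousLinearMap.apply 𝕜 F v)).congr_fun fun i => ?_)
    simp [S, b.repr_apply_apply]
  exact isCompactOperator_of_tendsto hsum (Eventually.of_forall fun s =>
    Submodule.sum_mem (compactOperator (RingHom.id 𝕜) H F) fun i _ =>
      (isCompactOperator_of_locallyCompactSpace_dom (innerSL 𝕜 (b i))).clm_comp
        (ContinuousLinearMap.toSpanSingleton 𝕜 (T (b i))))

/-- The unit vectors as a Hilbert basis of `ℓ²`. -/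
def unitBasis : HilbertBasis ℕ ℂ L2 := ⟨LinearIsometryEquiv.refl ℂ L2⟩

theorem unitBasis_apply (i : ℕ) : unitBasis i = lp.single 2 i (1 : ℂ) :=
  (unitBasis.repr_symm_single i).symm

theorem isCompactOperator_iotaHom (x : SmoothOp) : IsCompactOperator (iotaHom x) := by
  obtain ⟨C, -, hC⟩ := exists_bound x 0 2
  refine isCompactOperator_of_summable_norm_apply unitBasis
    ((summable_inv_succ_sq.mul_left C).of_nonneg_of_le (fun i => norm_nonneg _) fun i => ?_)
  have hi := hC (unitSDual i) (hasSum_unit _ i).summable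
  rw [wNorm_unit] at hi
  rw [unitBasis_apply]
  calc ‖iotaHom x (lp.single 2 i (1 : ℂ))‖ = wNorm (0 : ℕ) (x (unitSDual i)) :=
        (wNorm_L2 (j₁ (x (unitSDual i)))).symm
    _ ≤ C * (1 / ((i : ℝ) + 1) ^ 2) := by rwa [one_div, ← zpow_natCast, ← zpow_neg]

theorem finiteDimensional_range_iotaHom {P : SmoothOp} (hP : IsIdempotentElem P) :
    FiniteDimensional ℂ (iotaHom P).range := by
  have := ContinuousLinearMap.finite_dimensional_eigenspace (isCompactOperator_iotaHom P) 1
    one_ne_zero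
  refine Submodule.finiteDimensional_of_le
    (S₂ := Module.End.eigenspace (iotaHom P).toLinearMap 1) ?_
  rintro _ ⟨ξ, rfl⟩
  rw [Module.End.mem_eigenspace_iff, one_smul]
  exact congrArg (fun T : L2 →L[ℂ] L2 => T ξ) (congrArg iotaHom hP)

end Compactness

section SpectralProjections

variable {E : NonUnitalStarSubalgebra ℂ SmoothOp}

theorem weightedOp_mul_mul (q : ℕ) (x z : SmoothOp) : weightedOp q (x * z * x) =
    ((toWeighted q).comp (x.comp j₂)).comp
      ((iotaHom z).comp (j₁.comp (x.comp (ofWeighted q)))) := rfl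

theorem exists_mem_iotaHom_eq_mul_mul (hE : IsClosed (E : Set SmoothOp)) {x : SmoothOp}
    (hx : x ∈ E) {z : ℕ → SmoothOp} (hz : ∀ n, z n ∈ E) {T : L2 →L[ℂ] L2}
    (hT : Tendsto (fun n => iotaHom (z n)) atTop (𝓝 T)) :
    ∃ w ∈ E, iotaHom w = iotaHom x * T * iotaHom x := by
  have hlim : ∀ q, Tendsto (fun n => weightedOp q (x * z n * x)) atTop
      (𝓝 (((toWeighted q).comp (x.comp j₂)).comp (T.comp (j₁.comp (x.comp (ofWeighted q)))))) := by
    intro q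
    simp only [weightedOp_mul_mul]
    exact ((continuous_const.clm_comp (continuous_id.clm_comp continuous_const)).tendsto T).comp hT
  obtain ⟨w, hw⟩ := exists_tendsto_of_weightedOp hlim
  refine ⟨w, hE.mem_of_tendsto hw (Eventually.of_forall fun n =>
    mul_mem (mul_mem hx (hz n)) hx),
    tendsto_nhds_unique ((continuous_iotaHom.tendsto w).comp hw) ?_⟩
  simpa only [Function.comp_def, map_mul] using (hT.const_mul (iotaHom x)).mul_const (iotaHom x)

theorem exists_mem_iotaHom_eq_pow_succ {x : SmoothOp} (hx : x ∈ E) (n : ℕ) :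
    ∃ z ∈ E, iotaHom z = iotaHom x ^ (n + 1) := by
  induction n with
  | zero => exact ⟨x, hx, by rw [zero_add, pow_one]⟩
  | succ n ih =>
    obtain ⟨z, hz, hzx⟩ := ih
    exact ⟨z * x, mul_mem hz hx, by rw [map_mul, hzx, ← pow_succ]⟩

theorem exists_mem_iotaHom_eq_fixedProjection (hE : IsClosed (E : Set SmoothOp)) {x : SmoothOp}
    (hx : x ∈ E) (hpos : 0 ≤ iotaHom x) (hnorm : ‖iotaHom x‖ ≤ 1) :
    ∃ P ∈ E, iotaHom P = fixedProjection (iotaHom x) := by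
  choose z hz hzx using exists_mem_iotaHom_eq_pow_succ hx
  have hlim : Tendsto (fun n => iotaHom (z n)) atTop (𝓝 (fixedProjection (iotaHom x))) := by
    simpa only [hzx] using
      tendsto_pow_succ_fixedProjection (isCompactOperator_iotaHom x) hpos hnorm
  obtain ⟨P, hP, hPx⟩ := exists_mem_iotaHom_eq_mul_mul hE hx hz hlim
  rw [mul_fixedProjection, fixedProjection_mul (IsSelfAdjoint.of_nonneg hpos)] at hPx
  exact ⟨P, hP, hPx⟩

theorem exists_isStarProjection_star_mul_self_mul (hE : IsClosed (E : Set SmoothOp))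
    {z : SmoothOp} (hz : z ∈ E) (hz0 : z ≠ 0) :
    ∃ P ∈ E, IsStarProjection P ∧ P ≠ 0 ∧ ∃ μ : ℂ, μ ≠ 0 ∧ star z * z * P = μ • P := by
  set T := iotaHom (star z * z) with hT
  have hTz : T = star (iotaHom z) * iotaHom z := by rw [hT, map_mul, map_star]
  have hT0 : ‖T‖ ≠ 0 := by
    rw [norm_ne_zero_iff, hTz]
    exact fun h => hz0 <| iotaHom_injective <|
      ((CStarRing.star_mul_self_eq_zero_iff (iotaHom z)).1 h).trans (map_zero iotaHom).symm
  set x : SmoothOp := ((‖T‖⁻¹ : ℝ) : ℂ) • (star z * z) with hx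
  have hxT : iotaHom x = ((‖T‖⁻¹ : ℝ) : ℂ) • T := map_smul iotaHom _ _
  have hpos : 0 ≤ iotaHom x := by
    rw [hxT, hTz, ContinuousLinearMap.nonneg_iff_isPositive]
    exact ((ContinuousLinearMap.nonneg_iff_isPositive _).1
      (star_mul_self_nonneg _)).smul_of_nonneg
        (RCLike.ofReal_nonneg.2 (inv_nonneg.2 (norm_nonneg _)))
  have hnorm : ‖iotaHom x‖ = 1 := by
    rw [hxT, norm_smul, Complex.norm_real, norm_inv, norm_norm, inv_mul_cancel₀ hT0]
  obtain ⟨P, hP, hPx⟩ := exists_mem_iotaHom_eq_fixedProjection hE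
    (SMulMemClass.smul_mem _ (mul_mem (star_mem hz) hz)) hpos hnorm.le
  refine ⟨P, hP, isStarProjection_iotaHom_iff.1 (hPx ▸ isStarProjection_fixedProjection), ?_,
    (‖T‖ : ℂ), Complex.ofReal_ne_zero.2 hT0, ?_⟩
  · rintro rfl
    exact fixedProjection_ne_zero (isCompactOperator_iotaHom x) hpos hnorm
      (hPx.symm.trans (map_zero iotaHom))
  · have hxP : x * P = P := iotaHom_injective (by rw [map_mul, hPx, mul_fixedProjection])
    rw [hx, smul_mul_assoc, Complex.ofReal_inv, inv_smul_eq_iff₀ (Complex.ofReal_ne_zero.2 hT0)]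
      at hxP
    exact hxP

end SpectralProjections

section MinimalProjections

variable {E : NonUnitalStarSubalgebra ℂ SmoothOp} {P Q x : SmoothOp}

theorem range_iotaHom_le_of_mul_eq (hPQ : P * Q = Q) :
    (iotaHom Q).range ≤ (iotaHom P).range := by
  rintro _ ⟨ξ, rfl⟩
  exact ⟨iotaHom Q ξ, congrArg (fun T : L2 →L[ℂ] L2 => T ξ) (congrArg iotaHom hPQ)⟩

theorem eq_of_finrank_range_iotaHom_le (hP : IsIdempotentElem P) (hQ : IsIdempotentElem Q)
    (hQP : Q * P = Q) (hPQ : P * Q = Q)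
    (hle : Module.finrank ℂ (iotaHom P).range ≤ Module.finrank ℂ (iotaHom Q).range) : Q = P := by
  have := finiteDimensional_range_iotaHom hP
  have heq := Submodule.eq_of_le_of_finrank_le (range_iotaHom_le_of_mul_eq hPQ) hle
  refine hQP.symm.trans (iotaHom_injective ?_)
  ext1 ξ
  obtain ⟨ζ, hζ⟩ : iotaHom P ξ ∈ (iotaHom Q).range := heq ▸ ⟨ξ, rfl⟩
  calc iotaHom (Q * P) ξ = iotaHom Q (iotaHom P ξ) := rfl
    _ = iotaHom (Q * Q) ζ := congrArg (iotaHom Q) hζ.symm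
    _ = iotaHom P ξ := by rw [hQ.eq]; exact hζ

theorem exists_isMinimalProjection_mul_eq (hQ : Q ∈ E) (hQs : IsStarProjection Q) (hQ0 : Q ≠ 0) :
    ∃ P, IsMinimalProjection E P ∧ P * Q = P := by
  obtain ⟨P, ⟨hP, hPs, hP0, hPQ⟩, hmin⟩ := exists_minimalFor_of_wellFoundedLT
    (fun P => P ∈ E ∧ IsStarProjection P ∧ P ≠ 0 ∧ P * Q = P)
    (fun P => Module.finrank ℂ (iotaHom P).range) ⟨Q, hQ, hQs, hQ0, hQs.isIdempotentElem⟩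
  refine ⟨P, ⟨hP, hPs, hP0, fun R hR hRs hRP hPR => or_iff_not_imp_left.2 fun hR0 => ?_⟩, hPQ⟩
  have hRQ : R * Q = R := by rw [← hRP, mul_assoc, hPQ]
  have := finiteDimensional_range_iotaHom hPs.isIdempotentElem
  exact eq_of_finrank_range_iotaHom_le hPs.isIdempotentElem hRs.isIdempotentElem hRP hPR
    (hmin ⟨hR, hRs, hR0, hRQ⟩
      (Submodule.finrank_mono (range_iotaHom_le_of_mul_eq hPR)))

theorem eq_zero_of_forall_mul_eq_zero (hE : IsClosed (E : Set SmoothOp))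
    (hcomm : ∀ x ∈ E, ∀ y ∈ E, x * y = y * x) (hx : x ∈ E)
    (h : ∀ P, IsMinimalProjection E P → x * P = 0) : x = 0 := by
  by_contra hx0
  obtain ⟨Q, hQ, hQs, hQ0, μ, hμ, hxQ⟩ := exists_isStarProjection_star_mul_self_mul hE hx hx0
  obtain ⟨P, hP, hPQ⟩ := exists_isMinimalProjection_mul_eq hQ hQs hQ0
  refine hP.ne_zero ((smul_eq_zero.1 ?_).resolve_left hμ)
  calc μ • P = μ • Q * P := by rw [smul_mul_assoc, hcomm Q hQ P hP.mem, hPQ]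
    _ = star x * (x * P) * Q := by
      rw [← hxQ, mul_assoc, mul_assoc, hcomm Q hQ P hP.mem, mul_assoc, mul_assoc]
    _ = 0 := by rw [h P hP, mul_zero, zero_mul]

theorem four_smul_star_mul_eq_sum {A : Type*} [NonUnitalRing A] [StarRing A] [Module ℂ A]
    [StarModule ℂ A] [IsScalarTower ℂ A A] [SMulCommClass ℂ A A] (a b : A) :
    (4 : ℂ) • (star a * b) = ∑ k ∈ Finset.range 4, (-Complex.I) ^ k •
      (star (a + Complex.I ^ k • b) * (a + Complex.I ^ k • b)) := by
  have hI : star Complex.I = -Complex.I := Complex.conj_I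
  have hI2 : Complex.I ^ 2 = -1 := Complex.I_sq
  have hI3 : Complex.I ^ 3 = -Complex.I := Complex.I_pow_three
  simp only [Finset.sum_range_succ, Finset.sum_range_zero, star_add, star_smul, star_pow, hI,
    neg_pow Complex.I, hI2, hI3, add_mul, mul_add, smul_mul_assoc, mul_smul_comm]
  match_scalars <;> ring_nf <;> simp only [hI2] <;> norm_num

namespace IsMinimalProjection

theorem exists_star_mul_self_mul_eq_smul (hP : IsMinimalProjection E P)
    (hE : IsClosed (E : Set SmoothOp)) (hcomm : ∀ x ∈ E, ∀ y ∈ E, x * y = y * x) (hx : x ∈ E) :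
    ∃ c : ℂ, star x * x * P = c • P := by
  have hPP : P * P = P := hP.isStarProjection.isIdempotentElem
  rcases eq_or_ne (x * P) 0 with h0 | h0
  · exact ⟨0, by rw [mul_assoc, h0, mul_zero, zero_smul]⟩
  obtain ⟨Q, hQ, hQs, hQ0, μ, hμ, hxQ⟩ :=
    exists_isStarProjection_star_mul_self_mul hE (mul_mem hx hP.mem) h0
  have hxP : star (x * P) * (x * P) = star x * x * P := by
    rw [star_mul, hP.isStarProjection.isSelfAdjoint.star_eq, mul_assoc, ← mul_assoc (star x),
      hcomm P hP.mem _ (mul_mem (mul_mem (star_mem hx) hx) hP.mem), mul_assoc, hPP]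
  rw [hxP] at hxQ
  have hQP : Q * P = Q := by
    refine smul_right_injective SmoothOp hμ ?_
    change μ • (Q * P) = μ • Q
    rw [← smul_mul_assoc, ← hxQ, mul_assoc, hcomm Q hQ P hP.mem, ← mul_assoc,
      mul_assoc _ P P, hPP]
  have hQeq : Q = P :=
    (hP.minimal Q hQ hQs hQP ((hcomm P hP.mem Q hQ).trans hQP)).resolve_left hQ0
  exact ⟨μ, by rwa [hQeq, mul_assoc, hPP] at hxQ⟩

theorem exists_mul_eq_smul (hP : IsMinimalProjection E P) (hE : IsClosed (E : Set SmoothOp))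
    (hcomm : ∀ x ∈ E, ∀ y ∈ E, x * y = y * x) (hx : x ∈ E) : ∃ c : ℂ, x * P = c • P := by
  choose c hc using fun k : ℕ => hP.exists_star_mul_self_mul_eq_smul hE hcomm
    (add_mem hP.mem (SMulMemClass.smul_mem (Complex.I ^ k) hx))
  have hPx : P * x * P = x * P := by
    rw [hcomm P hP.mem x hx, mul_assoc, hP.isStarProjection.isIdempotentElem.eq]
  have hsum := congrArg (· * P) (four_smul_star_mul_eq_sum P x)
  simp only [hP.isStarProjection.isSelfAdjoint.star_eq, smul_mul_assoc, Finset.sum_mul, hPx,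
    hc, smul_smul, ← Finset.sum_smul] at hsum
  exact ⟨_, ((eq_inv_smul_iff₀ (by norm_num : (4 : ℂ) ≠ 0)).2 hsum).trans (smul_smul _ _ _)⟩

theorem mul_eq_zero (hP : IsMinimalProjection E P) (hQ : IsMinimalProjection E Q)
    (hcomm : ∀ x ∈ E, ∀ y ∈ E, x * y = y * x) (hne : P ≠ Q) : P * Q = 0 := by
  have hPP : P * P = P := hP.isStarProjection.isIdempotentElem
  have hQQ : Q * Q = Q := hQ.isStarProjection.isIdempotentElem
  have hPQ : Commute P Q := hcomm P hP.mem Q hQ.mem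
  have hmem : P * Q ∈ E := mul_mem hP.mem hQ.mem
  have hproj : IsStarProjection (P * Q) := hP.isStarProjection.mul hQ.isStarProjection hPQ
  have hP' : P * (P * Q) = P * Q := by rw [← mul_assoc, hPP]
  have hQ' : P * Q * Q = P * Q := by rw [mul_assoc, hQQ]
  by_contra h0
  have hPQP : P * Q = P :=
    (hP.minimal _ hmem hproj ((hcomm _ hmem P hP.mem).trans hP') hP').resolve_left h0
  have hPQQ : P * Q = Q :=
    (hQ.minimal _ hmem hproj hQ' ((hcomm Q hQ.mem _ hmem).trans hQ')).resolve_left h0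
  exact hne (hPQP.symm.trans hPQQ)

end IsMinimalProjection

end MinimalProjections

section CanonicalBasis

variable {E : NonUnitalStarSubalgebra ℂ SmoothOp} {P : SmoothOp}

theorem eq_blockAlgebra {f : ℕ → SSpace} {N : ℕ → Finset ℕ}
    (hE : IsClosed (E : Set SmoothOp)) (hcomm : ∀ x ∈ E, ∀ y ∈ E, x * y = y * x)
    (hf : IsOrthonormalSeq f) (hN : ∀ k, (N k).Nonempty)
    (hd : Pairwise fun k l => Disjoint (N k) (N l)) (hB : IsCanonicalBasis E (blockProj f N)) :
    E = blockAlgebra hf hN hd := by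
  have hmin : ∀ k, IsMinimalProjection E (blockProj f N k) := fun k =>
    hB.range_eq.subset (Set.mem_range_self k)
  have hge : blockAlgebra hf hN hd ≤ E := by
    rintro _ ⟨c, rfl⟩
    exact hE.mem_of_tendsto (hasSum_synthesis hf hN hd c) (Eventually.of_forall fun s =>
      sum_mem fun k _ => SMulMemClass.smul_mem _ (hmin k).mem)
  refine le_antisymm (fun x hx => ?_) hge
  have hscalar : x ∈ blockScalars f N := mem_blockScalars_of_forall_exists hf hN fun k =>
    (hmin k).exists_mul_eq_smul hE hcomm hx
  set c := coeffMap hf hN ⟨x, hscalar⟩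
  have hzero : x - synthesis hf hN hd c = 0 := by
    refine eq_zero_of_forall_mul_eq_zero hE hcomm (sub_mem hx (hge ⟨c, rfl⟩)) fun P hP => ?_
    obtain ⟨k, rfl⟩ : P ∈ Set.range (blockProj f N) := hB.range_eq.superset hP
    rw [sub_mul, hscalar k, synthesis_mul_blockProj]
    exact sub_self _
  rw [sub_eq_zero.1 hzero]
  exact ⟨c, rfl⟩

theorem mem_span_of_finite_isMinimalProjection (hE : IsClosed (E : Set SmoothOp))
    (hcomm : ∀ x ∈ E, ∀ y ∈ E, x * y = y * x) (hfin : {P | IsMinimalProjection E P}.Finite)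
    {x : SmoothOp} (hx : x ∈ E) : x ∈ Submodule.span ℂ {P | IsMinimalProjection E P} := by
  choose! c hc using fun P (hP : IsMinimalProjection E P) => hP.exists_mul_eq_smul hE hcomm hx
  have hmem : ∀ P ∈ hfin.toFinset, IsMinimalProjection E P := fun P hP => hfin.mem_toFinset.1 hP
  have hzero : x - ∑ P ∈ hfin.toFinset, c P • P = 0 := by
    refine eq_zero_of_forall_mul_eq_zero hE hcomm (sub_mem hx (sum_mem fun P hP =>
      SMulMemClass.smul_mem _ (hmem P hP).mem)) fun Q hQ => ?_
    rw [sub_mul, Finset.sum_mul, Finset.sum_eq_single Q, hc Q hQ, smul_mul_assoc,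
      hQ.isStarProjection.isIdempotentElem.eq, sub_self]
    · intro P hP hPQ
      rw [smul_mul_assoc, (hmem P hP).mul_eq_zero hQ hcomm hPQ, smul_zero]
    · exact fun h => absurd (hfin.mem_toFinset.2 hQ) h
  rw [sub_eq_zero.1 hzero]
  exact Submodule.sum_mem _ fun P hP => Submodule.smul_mem _ _ (Submodule.subset_span (hmem P hP))

theorem infinite_setOf_isMinimalProjection (hE : IsInfDimClosedComm E) :
    {P | IsMinimalProjection E P}.Infinite := by
  intro hfin
  have := FiniteDimensional.span_of_finite ℂ hfin
  have hle : E.toNonUnitalSubalgebra.toSubmodule ≤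
      Submodule.span ℂ {P | IsMinimalProjection E P} := fun x hx =>
    mem_span_of_finite_isMinimalProjection hE.isClosed hE.comm hfin hx
  exact hE.infinite_dimensional (Submodule.finiteDimensional_of_le hle)

theorem exists_orthonormal_sum_rankOne_eq (hP : IsStarProjection P) :
    ∃ (n : ℕ) (v : Fin n → SSpace), Orthonormal ℂ (fun i => j₁ (v i)) ∧
      (∀ i, iotaHom P (j₁ (v i)) = j₁ (v i)) ∧ ∑ i, rankOne (v i) = P := by
  have hproj := isStarProjection_iotaHom_iff.2 hP
  have hfin := finiteDimensional_range_iotaHom hP.isIdempotentElem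
  obtain ⟨_, hrange⟩ := isStarProjection_iff_eq_starProjection_range.1 hproj
  let b := stdOrthonormalBasis ℂ (iotaHom P).range
  have hfix : ∀ i, iotaHom P (b i : L2) = b i := by
    intro i
    obtain ⟨ξ, hξ⟩ := (b i).2
    rw [← hξ]
    exact congrArg (fun T : L2 →L[ℂ] L2 => T ξ) hproj.isIdempotentElem
  have hv : ∀ i, j₁ (P (j₂ (b i : L2))) = b i := hfix
  refine ⟨_, fun i => P (j₂ (b i : L2)), ?_, fun i => ?_, iotaHom_injective ?_⟩
  · simp only [hv]
    exact b.orthonormal.comp_linearIsometry (iotaHom P).range.subtypeₗᵢ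
  · rw [hv, hfix]
  · simp only [map_sum, iotaHom_rankOne, hv]
    exact b.starProjection_eq_sum_rankOne.symm.trans hrange.symm

theorem inner_eq_zero_of_mul_eq_zero {H : Type*} [NormedAddCommGroup H] [InnerProductSpace ℂ H]
    [CompleteSpace H] {S T : H →L[ℂ] H} (hS : IsSelfAdjoint S) (hST : S * T = 0) {u v : H}
    (hu : S u = u) (hv : T v = v) : ⟪u, v⟫_ℂ = 0 := by
  have hzero : S (T v) = 0 := congrArg (fun R : H →L[ℂ] H => R v) hST
  rw [← hu, ← hv, ← ContinuousLinearMap.adjoint_inner_right, hS.adjoint_eq, hzero,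
    inner_zero_right]

theorem exists_orthonormal_sigma_sum_rankOne_eq {ι : Type*} {p : ι → SmoothOp}
    (hp : ∀ i, IsStarProjection (p i)) (horth : Pairwise fun i j => p i * p j = 0) :
    ∃ (n : ι → ℕ) (v : (Σ i, Fin (n i)) → SSpace), Orthonormal ℂ (fun a => j₁ (v a)) ∧
      ∀ i, ∑ j, rankOne (v ⟨i, j⟩) = p i := by
  choose n v hv hfix hsum using fun i => exists_orthonormal_sum_rankOne_eq (hp i)
  refine ⟨n, fun a => v a.1 a.2, ⟨fun a => (hv a.1).1 a.2, ?_⟩, hsum⟩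
  rintro ⟨i, k⟩ ⟨j, l⟩ hne
  rcases eq_or_ne i j with rfl | hij
  · exact (hv i).2 fun h => hne (congrArg (Sigma.mk i) h)
  · refine inner_eq_zero_of_mul_eq_zero ((hp i).isSelfAdjoint.map iotaHom) ?_ (hfix i k) (hfix j l)
    rw [← map_mul, horth hij, map_zero]

theorem countable_of_orthonormal {ι κ 𝕜 H : Type*} [RCLike 𝕜] [NormedAddCommGroup H]
    [InnerProductSpace 𝕜 H] [Countable κ] (b : HilbertBasis κ 𝕜 H) {u : ι → H}
    (hu : Orthonormal 𝕜 u) : Countable ι := by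
  have hsupport : ∀ i, (Function.support fun a => ‖inner 𝕜 (u a) (b i)‖ ^ 2).Countable := fun i =>
    (hu.inner_products_summable (b i)).countable_support
  refine Set.countable_univ_iff.1 ((Set.countable_iUnion hsupport).mono fun a _ => ?_)
  by_contra h
  simp only [Set.mem_iUnion, Function.mem_support, not_exists, not_not] at h
  refine hu.ne_zero a (b.repr.map_eq_zero_iff.1 (lp.ext (funext fun i => ?_)))
  rw [b.repr_apply_apply, ← inner_conj_symm,
    norm_eq_zero.1 (pow_eq_zero_iff two_ne_zero |>.1 (h i)), map_zero]
  rfl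

theorem countable_of_mul_eq_zero {ι : Type*} {p : ι → SmoothOp}
    (hp : ∀ i, IsStarProjection (p i)) (hp0 : ∀ i, p i ≠ 0)
    (horth : Pairwise fun i j => p i * p j = 0) : Countable ι := by
  obtain ⟨n, v, hv, hsum⟩ := exists_orthonormal_sigma_sum_rankOne_eq hp horth
  have := countable_of_orthonormal unitBasis hv
  refine Function.Surjective.countable (f := fun a : Σ i, Fin (n i) => a.1) fun i => ?_
  obtain ⟨j, -⟩ := Finset.exists_ne_zero_of_sum_ne_zero ((hsum i).symm ▸ hp0 i)
  exact ⟨⟨i, j⟩, rfl⟩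

/-- The block of indices that the enumeration `e` assigns to the `i`-th fibre of a sigma type. -/
def sigmaFiber {α ι : Type*} {κ : ι → Type*} [∀ i, Fintype (κ i)] (e : α ≃ Σ i, κ i) (i : ι) :
    Finset α :=
  Finset.univ.map ((Function.Embedding.sigmaMk i).trans e.symm.toEmbedding)

theorem mem_sigmaFiber {α ι : Type*} {κ : ι → Type*} [∀ i, Fintype (κ i)] {e : α ≃ Σ i, κ i}
    {i : ι} {a : α} : a ∈ sigmaFiber e i ↔ (e a).1 = i := by
  simp only [sigmaFiber, Finset.mem_map, Finset.mem_univ, true_and]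
  constructor
  · rintro ⟨j, rfl⟩
    exact congrArg Sigma.fst (e.apply_symm_apply ⟨i, j⟩)
  · rintro rfl
    exact ⟨(e a).2, e.symm_apply_apply a⟩

theorem exists_blockProj_eq {p : ℕ → SmoothOp} (hp : ∀ k, IsStarProjection (p k))
    (hp0 : ∀ k, p k ≠ 0) (horth : Pairwise fun k l => p k * p l = 0) :
    ∃ (f : ℕ → SSpace) (_ : IsOrthonormalSeq f) (N : ℕ → Finset ℕ),
      (∀ k, (N k).Nonempty) ∧ (Pairwise fun k l => Disjoint (N k) (N l)) ∧ blockProj f N = p := by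
  obtain ⟨n, v, hv, hsum⟩ := exists_orthonormal_sigma_sum_rankOne_eq hp horth
  have hne : ∀ k, Nonempty (Fin (n k)) := fun k =>
    ⟨(Finset.exists_ne_zero_of_sum_ne_zero ((hsum k).symm ▸ hp0 k)).choose⟩
  have : Infinite (Σ k, Fin (n k)) := Infinite.of_surjective Sigma.fst fun k =>
    ⟨⟨k, (hne k).some⟩, rfl⟩
  obtain ⟨e⟩ : Nonempty (ℕ ≃ Σ k, Fin (n k)) := nonempty_equiv_of_countable
  refine ⟨fun m => v (e m), hv.comp e e.injective, sigmaFiber e, fun k => ?_, fun k l hkl => ?_,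
    funext fun k => ?_⟩
  · exact Finset.univ_nonempty.map
  · exact Finset.disjoint_left.2 fun m hk hl =>
      hkl ((mem_sigmaFiber.1 hk).symm.trans (mem_sigmaFiber.1 hl))
  · rw [← hsum k, blockProj, sigmaFiber, Finset.sum_map]
    exact Finset.sum_congr rfl fun j _ =>
      congrArg (fun a => rankOne (v a)) (e.apply_symm_apply ⟨k, j⟩)

theorem exists_isCanonicalBasis_blockProj (hE : IsInfDimClosedComm E) :
    ∃ (f : ℕ → SSpace) (_ : IsOrthonormalSeq f) (N : ℕ → Finset ℕ),
      (∀ k, (N k).Nonempty) ∧ (Pairwise fun k l => Disjoint (N k) (N l)) ∧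
        IsCanonicalBasis E (blockProj f N) := by
  let M := {P | IsMinimalProjection E P}
  have : Infinite M := (infinite_setOf_isMinimalProjection hE).to_subtype
  have horth : Pairwise fun P Q : M => (P : SmoothOp) * Q = 0 := fun P Q hne =>
    P.2.mul_eq_zero Q.2 hE.comm (Subtype.coe_ne_coe.2 hne)
  have : Countable M :=
    countable_of_mul_eq_zero (fun P : M => P.2.isStarProjection) (fun P => P.2.ne_zero) horth
  obtain ⟨g⟩ : Nonempty (ℕ ≃ M) := nonempty_equiv_of_countable
  obtain ⟨f, hf, N, hN, hd, hfN⟩ := exists_blockProj_eq (fun k => (g k).2.isStarProjection)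
    (fun k => (g k).2.ne_zero) (horth.comp_of_injective g.injective)
  refine ⟨f, hf, N, hN, hd, ?_, ?_⟩
  · rw [hfN]
    exact Subtype.val_injective.comp g.injective
  · rw [hfN]
    exact (g.surjective.range_comp (Subtype.val : M → SmoothOp)).trans Subtype.range_val

end CanonicalBasis

end SmoothOperators

end

open SmoothOperators in
theorem mainTheorem3 :
    -- every `E` is of this form
    (∀ E : NonUnitalStarSubalgebra ℂ SmoothOp, IsInfDimClosedComm E →
      ∃ (f : ℕ → SSpace) (hf : IsOrthonormalSeq f) (N : ℕ → Finset ℕ)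
        (hN : ∀ k, (N k).Nonempty),
        Pairwise (fun k l => Disjoint (N k) (N l)) ∧
        IsCanonicalBasis E (blockProj f N) ∧ IsSchauderBasis E (blockProj f N) ∧
        IsoVia E (blockProj f N) (maxMatrix f hf N hN)) ∧
    -- any representation of the canonical basis yields the isomorphism
    (∀ E : NonUnitalStarSubalgebra ℂ SmoothOp, IsInfDimClosedComm E →
      ∀ (f : ℕ → SSpace) (hf : IsOrthonormalSeq f) (N : ℕ → Finset ℕ)
        (hN : ∀ k, (N k).Nonempty),
        Pairwise (fun k l => Disjoint (N k) (N l)) →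
        IsCanonicalBasis E (blockProj f N) →
        IsSchauderBasis E (blockProj f N) ∧
        IsoVia E (blockProj f N) (maxMatrix f hf N hN)) ∧
    -- conversely, all such Köthe algebras arise
    (∀ (f : ℕ → SSpace) (hf : IsOrthonormalSeq f) (N : ℕ → Finset ℕ)
        (hN : ∀ k, (N k).Nonempty),
        Pairwise (fun k l => Disjoint (N k) (N l)) →
        ∃ E : NonUnitalStarSubalgebra ℂ SmoothOp, IsInfDimClosedComm E ∧
          IsCanonicalBasis E (blockProj f N) ∧ IsSchauderBasis E (blockProj f N) ∧
          IsoVia E (blockProj f N) (maxMatrix f hf N hN)) := by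
  refine ⟨fun E hE => ?_, fun E hE f hf N hN hd hB => ?_, fun f hf N hN hd => ?_⟩
  · obtain ⟨f, hf, N, hN, hd, hB⟩ := exists_isCanonicalBasis_blockProj hE
    obtain rfl := eq_blockAlgebra hE.isClosed hE.comm hf hN hd hB
    exact ⟨f, hf, N, hN, hd, hB, isSchauderBasis_blockAlgebra hf hN hd,
      isoVia_blockAlgebra hf hN hd⟩
  · obtain rfl := eq_blockAlgebra hE.isClosed hE.comm hf hN hd hB
    exact ⟨isSchauderBasis_blockAlgebra hf hN hd, isoVia_blockAlgebra hf hN hd⟩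
  · exact ⟨blockAlgebra hf hN hd, isInfDimClosedComm_blockAlgebra hf hN hd,
      isCanonicalBasis_blockAlgebra hf hN hd, isSchauderBasis_blockAlgebra hf hN hd,
      isoVia_blockAlgebra hf hN hd⟩
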